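/- Let $d\ge 2$ and let $f:\mathbb R^d\to\mathbb R$ be twice differentiable, $\mu$-strongly convex and $L$-smooth, i.e. $\mu I\preceq\nabla^2 f(x)\preceq L I$ for all $x$ ($\mu,L>0$), with condition number $\varkappa=L/\mu$, and $M$-strongly self-concordant ($M>0$), i.e. $\nabla^2 f(y)-\nabla^2 f(x)\preceq M\|y-x\|_z\nabla^2 f(w)$ for all $x,y,z,w$. Here $\preceq$ is the order of symmetric matrices given by positive semidefiniteness, $\|v\|_A=\sqrt{v^\top A v}$ and $\|v\|_z=\|v\|_{\nabla^2 f(z)}$. Put $\lambda_f(x)=\sqrt{\nabla f(x)^\top[\nabla^2 f(x)]^{-1}\nabla f(x)}$. For $G\succeq A\succ0$ put $\sigma_A(G)=\mathrm{tr}[(G-A)A^{-1}]$ and, for $u\in\mathbb R^d$, $$\mathrm{SR1}(G,A,u)=G-\frac{(G-A)uu^\top(G-A)}{u^\top(G-A)u}\ \text{ if }Gu\ne Au,\qquad \mathrm{SR1}(G,A,u)=G\ \text{ if }Gu=Au,$$ $$\mathrm{BFGS}(G,A,u)=G-\frac{Guu^\top G}{u^\top Gu}+\frac{Auu^\top A}{u^\top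 Au}\ \text{ if }u\neq 0,\qquad \mathrm{BFGS}(G,A,0)=G.$$ Both methods start from deterministic $x_0\in\mathbb R^d$ and $G_0$ such that, for some $\eta\ge1$, $$\nabla^2 f(x_0)\preceq G_0\preceq\eta\,\nabla^2 f(x_0).$$ For $k\ge0$ they set $$x_{k+1}=x_k-G_k^{-1}\nabla f(x_k),\qquad r_k=\|x_{k+1}-x_k\|_{x_k},\qquad \tilde G_k=(1+Mr_k)G_k,\qquad A_{k+1}=\nabla^2 f(x_{k+1}),$$ and then compute $G_{k+1}$ as follows. * **SR1.** $G_{k+1}=\mathrm{SR1}(\tilde G_k,A_{k+1},u_k)$. In the greedy method $u_k$ is any maximizer of $u^\top(\tilde G_k-A_{k+1})u$ over $u\in\{e_1,\dots,e_d\}$. In the random method $u_0,u_1,\dots$ are i.i.d. with a spherically symmetric law that does not charge $0$ (for instance $\mathrm{Unif}(\mathcal S^{d-1})$ or $\mathcal N(0,I_d)$). * **BFGS.** The method also carries square matrices $L_k$ with $L_k^\top L_k=G_k^{-1}$; $L_0$ is any square matrix with $L_0^\top L_0=G_0^{-1}$. With $\tilde L_k=L_k/\sqrt{1+Mr_k}$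 and $u_k=\tilde L_k^\top\tilde u_k$, set $G_{k+1}=\mathrm{BFGS}(\tilde G_k,A_{k+1},u_k)$ and $$L_{k+1}=\tilde L_k-\frac{(\tilde L_kA_{k+1}u_k-v_k)u_k^\top}{u_k^\top A_{k+1}u_k},\qquad v_k=\frac{\|u_k\|_{A_{k+1}}}{\|\tilde u_k\|}\tilde u_k$$ ($L_{k+1}=\tilde L_k$ if $\tilde u_k=0$). In the greedy method $\tilde u_k$ is any maximizer of $\tilde u^\top\tilde L_k^{-\top}A_{k+1}^{-1}\tilde L_k^{-1}\tilde u$ over $\tilde u\in\{e_1,\dots,e_d\}$. In the random method $\tilde u_0,\tilde u_1,\dots$ are i.i.d. with a law satisfying $\mathbb E\big[\tilde u\tilde u^\top/(\tilde u^\top\tilde u)\big]=\frac1d I_d$ (for instance $\mathrm{Unif}(\mathcal S^{d-1})$). Write $\lambda_k=\lambda_f(x_k)$ and $\sigma_k=\sigma_{\nabla^2 f(x_k)}(G_k)$. **Theorem.** (1) Suppose $M\lambda_0\le\dfrac{\ln 2}{4\eta(2d+1)}$. For greedy BFGS, for all $k\ge0$, $\nabla^2 f(x_k)\preceq G_k$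 and $$\sigma_k\le 2d\eta\Big(1-\frac1d\Big)^k,\qquad \lambda_k\le(2d\eta)^k\Big(1-\frac1d\Big)^{k(k-1)/2}\lambda_0 .$$ For random BFGS and every $\delta\in(0,1)$, with probability at least $1-\delta$, for all $k\ge0$ simultaneously, $\nabla^2 f(x_k)\preceq G_k$ and $$\sigma_k\le\frac{4d^3\eta}{\delta}\Big(1-\frac1{d+1}\Big)^k,\qquad \lambda_k\le\Big(\frac{4d^3\eta}{\delta}\Big)^k\Big(1-\frac1{d+1}\Big)^{k(k-1)/2}\lambda_0 .$$ (2) Suppose $M\lambda_0\le\dfrac{\ln 2}{4\eta(2d\varkappa+1)}$. For greedy SR1, for all $k\ge0$, $\nabla^2 f(x_k)\preceq G_k$ and $$\sigma_k\le 2d\varkappa\eta\Big(1-\frac1d\Big)^k,\qquad \lambda_k\le(2d\varkappa\eta)^k\Big(1-\frac1d\Big)^{k(k-1)/2}\lambda_0 .$$ For random SR1 and every $\delta\in(0,1)$, with probability at least $1-\delta$, for all $k\ge0$ simultaneously, $\nabla^2 f(x_k)\preceq G_k$ and $$\sigma_k\le\frac{4d^3\varkappa\eta}{\delta}\Big(1-\frac1{d+1}\Big)^k,\qquad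 \lambda_k\le\Big(\frac{4d^3\varkappa\eta}{\delta}\Big)^k\Big(1-\frac1{d+1}\Big)^{k(k-1)/2}\lambda_0 .$$ -/

import Mathlib

open MeasureTheory ProbabilityTheory Matrix

noncomputable section

namespace QuasiNewton

/-! The space `ℝ^d` is `Fin d → ℝ`; every Euclidean quantity is written through the dot product, so
that the sup norm carried by `Fin d → ℝ` plays no role (differentiability does not depend on the
choice of the norm). -/

/-- The gradient of `f` at `x`, as the vector of partial derivatives. -/
def grad {d : ℕ} (f : (Fin d → ℝ) → ℝ) (x : Fin d → ℝ) : Fin d → ℝ :=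
  fun i => fderiv ℝ f x (Pi.single i 1)

/-- The Hessian matrix of `f` at `x`. -/
def hess {d : ℕ} (f : (Fin d → ℝ) → ℝ) (x : Fin d → ℝ) : Matrix (Fin d) (Fin d) ℝ :=
  Matrix.of fun i j => fderiv ℝ (fderiv ℝ f) x (Pi.single i 1) (Pi.single j 1)

/-- The Loewner order `A ⪯ B`: the matrix `B - A` is symmetric positive semidefinite. -/
def LoewnerLE {d : ℕ} (A B : Matrix (Fin d) (Fin d) ℝ) : Prop := (B - A).PosSemidef

/-- `f` is twice differentiable on the whole space. -/
def TwiceDifferentiable {d : ℕ} (f : (Fin d → ℝ) → ℝ) : Prop :=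
  Differentiable ℝ f ∧ Differentiable ℝ (fderiv ℝ f)

/-- The norm `‖v‖_A = √(vᵀ A v)` induced by a positive definite matrix `A`. -/
def weightedNorm {d : ℕ} (A : Matrix (Fin d) (Fin d) ℝ) (v : Fin d → ℝ) : ℝ :=
  √(v ⬝ᵥ (A *ᵥ v))

/-- `f` is `μ`-strongly convex and `L`-smooth: `μ I ⪯ ∇²f(x) ⪯ L I` for all `x`. -/
structure StronglyConvexSmooth {d : ℕ} (μ L : ℝ) (f : (Fin d → ℝ) → ℝ) : Prop where
  convexity_pos : 0 < μ
  smoothness_pos : 0 < L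
  twice_differentiable : TwiceDifferentiable f
  lower : ∀ x, LoewnerLE (μ • (1 : Matrix (Fin d) (Fin d) ℝ)) (hess f x)
  upper : ∀ x, LoewnerLE (hess f x) (L • (1 : Matrix (Fin d) (Fin d) ℝ))

/-- `f` is `M`-strongly self-concordant:
`∇²f(y) - ∇²f(x) ⪯ M ‖y - x‖_z ∇²f(w)` for all `x, y, z, w`. -/
structure StronglySelfConcordant {d : ℕ} (M : ℝ) (f : (Fin d → ℝ) → ℝ) : Prop where
  constant_pos : 0 < M
  twice_differentiable : TwiceDifferentiable f
  hessian_close : ∀ x y z w,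
    LoewnerLE (hess f y - hess f x) ((M * weightedNorm (hess f z) (y - x)) • hess f w)

/-- `λ_f(x) = √(∇f(x)ᵀ [∇²f(x)]⁻¹ ∇f(x))`. -/
def lam {d : ℕ} (f : (Fin d → ℝ) → ℝ) (x : Fin d → ℝ) : ℝ :=
  √(grad f x ⬝ᵥ ((hess f x)⁻¹ *ᵥ grad f x))

/-- `σ_A(G) = tr[(G - A) A⁻¹]`. -/
def sigma {d : ℕ} (A G : Matrix (Fin d) (Fin d) ℝ) : ℝ := ((G - A) * A⁻¹).trace

open Classical in
/-- The SR1 update of `G` towards `A` along `u` (no change if `G u = A u`). -/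
def SR1 {d : ℕ} (G A : Matrix (Fin d) (Fin d) ℝ) (u : Fin d → ℝ) : Matrix (Fin d) (Fin d) ℝ :=
  if G *ᵥ u = A *ᵥ u then G
  else G - (u ⬝ᵥ ((G - A) *ᵥ u))⁻¹ • vecMulVec ((G - A) *ᵥ u) (u ᵥ* (G - A))

/-- The BFGS update of `G` towards `A` along `u ≠ 0` (for `u = 0` this formula returns `G`). -/
def BFGS {d : ℕ} (G A : Matrix (Fin d) (Fin d) ℝ) (u : Fin d → ℝ) : Matrix (Fin d) (Fin d) ℝ :=
  G - (u ⬝ᵥ (G *ᵥ u))⁻¹ • vecMulVec (G *ᵥ u) (u ᵥ* G)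
    + (u ⬝ᵥ (A *ᵥ u))⁻¹ • vecMulVec (A *ᵥ u) (u ᵥ* A)

/-- The update of the factor `K` (with `Kᵀ K = G⁻¹`) that goes with the BFGS update of `G`
towards `A` along `u = Kᵀ w`:
`K₊ = K - (K A u - v) uᵀ / (uᵀ A u)` with `v = (‖u‖_A / ‖w‖) w`. -/
def factorUpdate {d : ℕ} (K A : Matrix (Fin d) (Fin d) ℝ) (w : Fin d → ℝ) :
    Matrix (Fin d) (Fin d) ℝ :=
  let u := Kᵀ *ᵥ w
  let v := (weightedNorm A u / √(w ⬝ᵥ w)) • w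
  K - (u ⬝ᵥ (A *ᵥ u))⁻¹ • vecMulVec (K *ᵥ (A *ᵥ u) - v) u

/-- The quasi-Newton step `x₊ = x - G⁻¹ ∇f(x)`. -/
def nextPoint {d : ℕ} (f : (Fin d → ℝ) → ℝ) (x : Fin d → ℝ) (G : Matrix (Fin d) (Fin d) ℝ) :
    Fin d → ℝ :=
  x - G⁻¹ *ᵥ grad f x

/-- The correction factor `1 + M r`, where `r = ‖x₊ - x‖_x`. -/
def corr {d : ℕ} (f : (Fin d → ℝ) → ℝ) (M : ℝ) (x : Fin d → ℝ)
    (G : Matrix (Fin d) (Fin d) ℝ) : ℝ :=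
  1 + M * weightedNorm (hess f x) (nextPoint f x G - x)

/-- The iterates `x_k`, `G_k` of the SR1 method. -/
structure SR1State (d : ℕ) where
  x : Fin d → ℝ
  G : Matrix (Fin d) (Fin d) ℝ

namespace SR1State

/-- The corrected matrix `(1 + M r) G`. -/
def corrG {d : ℕ} (f : (Fin d → ℝ) → ℝ) (M : ℝ) (s : SR1State d) : Matrix (Fin d) (Fin d) ℝ :=
  corr f M s.x s.G • s.G

/-- One iteration of the SR1 method with direction `u`. -/
def step {d : ℕ} (f : (Fin d → ℝ) → ℝ) (M : ℝ) (s : SR1State d) (u : Fin d → ℝ) : SR1State d where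
  x := nextPoint f s.x s.G
  G := SR1 (s.corrG f M) (hess f (nextPoint f s.x s.G)) u

end SR1State

/-- The run of the SR1 method from `(x₀, G₀)` with directions `u 0, u 1, …`. -/
def sr1Run {d : ℕ} (f : (Fin d → ℝ) → ℝ) (M : ℝ) (x₀ : Fin d → ℝ)
    (G₀ : Matrix (Fin d) (Fin d) ℝ) (u : ℕ → Fin d → ℝ) : ℕ → SR1State d
  | 0 => ⟨x₀, G₀⟩
  | k + 1 => (sr1Run f M x₀ G₀ u k).step f M (u k)

/-- The iterates `x_k`, `G_k` and the factors `K_k` (with `K_kᵀ K_k = G_k⁻¹`) of the BFGS method. -/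
structure BFGSState (d : ℕ) where
  x : Fin d → ℝ
  G : Matrix (Fin d) (Fin d) ℝ
  K : Matrix (Fin d) (Fin d) ℝ

namespace BFGSState

/-- The corrected matrix `(1 + M r) G`. -/
def corrG {d : ℕ} (f : (Fin d → ℝ) → ℝ) (M : ℝ) (s : BFGSState d) : Matrix (Fin d) (Fin d) ℝ :=
  corr f M s.x s.G • s.G

/-- The corrected factor `K / √(1 + M r)`. -/
def corrK {d : ℕ} (f : (Fin d → ℝ) → ℝ) (M : ℝ) (s : BFGSState d) : Matrix (Fin d) (Fin d) ℝ :=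
  (√(corr f M s.x s.G))⁻¹ • s.K

/-- One iteration of the BFGS method with unscaled direction `w`; the update of `G` is along
the scaled direction `Kᵀ w`, where `K` is the corrected factor. -/
def step {d : ℕ} (f : (Fin d → ℝ) → ℝ) (M : ℝ) (s : BFGSState d) (w : Fin d → ℝ) :
    BFGSState d where
  x := nextPoint f s.x s.G
  G := BFGS (s.corrG f M) (hess f (nextPoint f s.x s.G)) ((s.corrK f M)ᵀ *ᵥ w)
  K := factorUpdate (s.corrK f M) (hess f (nextPoint f s.x s.G)) w

end BFGSState

/-- The run of the BFGS method from `(x₀, G₀, K₀)` with unscaled directions `w 0, w 1, …`. -/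
def bfgsRun {d : ℕ} (f : (Fin d → ℝ) → ℝ) (M : ℝ) (x₀ : Fin d → ℝ)
    (G₀ K₀ : Matrix (Fin d) (Fin d) ℝ) (w : ℕ → Fin d → ℝ) : ℕ → BFGSState d
  | 0 => ⟨x₀, G₀, K₀⟩
  | k + 1 => (bfgsRun f M x₀ G₀ K₀ w k).step f M (w k)

/-- `u` maximizes the quadratic form of `B` over the coordinate vectors `e₁, …, e_d`
(any maximizer is allowed in case of a tie). -/
def IsCoordArgmax {d : ℕ} (B : Matrix (Fin d) (Fin d) ℝ) (u : Fin d → ℝ) : Prop :=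
  ∃ i : Fin d, u = Pi.single i 1 ∧
    ∀ j : Fin d, (Pi.single j 1 : Fin d → ℝ) ⬝ᵥ (B *ᵥ Pi.single j 1) ≤ u ⬝ᵥ (B *ᵥ u)

/-- The directions `u` are those of the greedy SR1 method: at step `k`, `u k` maximizes
`uᵀ (G - A) u` over the coordinate vectors, for the corrected matrix `G` of step `k` and
`A = ∇²f(x_{k+1})`. -/
def IsGreedySR1 {d : ℕ} (f : (Fin d → ℝ) → ℝ) (M : ℝ) (x₀ : Fin d → ℝ)
    (G₀ : Matrix (Fin d) (Fin d) ℝ) (u : ℕ → Fin d → ℝ) : Prop :=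
  ∀ k, IsCoordArgmax ((sr1Run f M x₀ G₀ u k).corrG f M - hess f (sr1Run f M x₀ G₀ u (k + 1)).x)
    (u k)

/-- The unscaled directions `w` are those of the greedy BFGS method: at step `k`, `w k` maximizes
`wᵀ K⁻ᵀ A⁻¹ K⁻¹ w` over the coordinate vectors, for the corrected factor `K` of step `k` and
`A = ∇²f(x_{k+1})`. -/
def IsGreedyBFGS {d : ℕ} (f : (Fin d → ℝ) → ℝ) (M : ℝ) (x₀ : Fin d → ℝ)
    (G₀ K₀ : Matrix (Fin d) (Fin d) ℝ) (w : ℕ → Fin d → ℝ) : Prop :=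
  ∀ k, IsCoordArgmax
    ((((bfgsRun f M x₀ G₀ K₀ w k).corrK f M)⁻¹)ᵀ * (hess f (bfgsRun f M x₀ G₀ K₀ w (k + 1)).x)⁻¹ *
      ((bfgsRun f M x₀ G₀ K₀ w k).corrK f M)⁻¹) (w k)

/-- The law `ν` on `ℝ^d` satisfies `E[u uᵀ / (uᵀ u)] = I / d`. The integrands are bounded by `1`;
taking traces, the identity forces `ν {0} = 0`. -/
def IsIsotropicDirection {d : ℕ} (ν : Measure (Fin d → ℝ)) : Prop :=
  IsProbabilityMeasure ν ∧
    (Matrix.of fun i j => ∫ u, u i * u j / (u ⬝ᵥ u) ∂ν) =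
      (1 / (d : ℝ)) • (1 : Matrix (Fin d) (Fin d) ℝ)

/-- The law `ν` on `ℝ^d` is spherically symmetric, i.e. invariant under all orthogonal matrices,
and does not charge the origin: for instance the standard Gaussian law, or the uniform law on the
unit sphere. -/
def IsSphericallySymmetric {d : ℕ} (ν : Measure (Fin d → ℝ)) : Prop :=
  IsProbabilityMeasure ν ∧ ν {0} = 0 ∧
    ∀ Q ∈ Matrix.orthogonalGroup (Fin d) ℝ, ν.map (fun u => Q *ᵥ u) = ν

/-- The random vectors `u 0, u 1, …` are independent with common law `ν`. -/
def IsIIDWithLaw {d : ℕ} {Ω : Type*} [MeasurableSpace Ω] (P : Measure Ω)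
    (u : ℕ → Ω → Fin d → ℝ) (ν : Measure (Fin d → ℝ)) : Prop :=
  (∀ k, Measurable (u k)) ∧ (∀ k, P.map (u k) = ν) ∧ iIndepFun u P

/-- The rates with constant `C` and ratio `ρ` along a sequence `(x_k, G_k)`: for all `k`,
`∇²f(x_k) ⪯ G_k` (which is what makes `σ_k` meaningful), `σ_k ≤ C ρ^k` and
`λ_k ≤ C^k ρ^(k(k-1)/2) λ_0`. -/
def HasRates {d : ℕ} (f : (Fin d → ℝ) → ℝ) (x : ℕ → Fin d → ℝ)
    (G : ℕ → Matrix (Fin d) (Fin d) ℝ) (C ρ : ℝ) : Prop :=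
  ∀ k : ℕ, LoewnerLE (hess f (x k)) (G k) ∧
    sigma (hess f (x k)) (G k) ≤ C * ρ ^ k ∧
    lam f (x k) ≤ C ^ k * ρ ^ (k * (k - 1) / 2) * lam f (x 0)

end QuasiNewton

end

/-! The argument combines three estimates.

Newton decrement. Let `h` be the step from `x` to `x₊`, so `G h = -∇f(x)`. Pairing `∇f(x₊)` with `y
= ∇²f(x₊)⁻¹ ∇f(x₊)` and using the mean value theorem gives `λ₊² = yᵀ(H - G)h`, where `H` is a
Hessian on the segment. If `(1 - ρ)G ⪯ H ⪯ (1 + ρ)G`, then `(H - G)H⁻¹(H - G) ⪯ ρ² G H⁻¹ G`, and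
Cauchy–Schwarz yields `λ₊ ≤ (1 + m/2) ρ λ` with `m = M r` (`lam_nextPoint_le`). Two choices of `ρ`
matter. One gives a linear rate `q = 1 - 1/(2η)` for any update that preserves two-sided bounds
(`IsUpdateRun.linear_rate`). The other gives `λ₊ ≤ (σ + 2Mλ) λ` (`lam_nextPoint_le_sigma`), which
becomes superlinear once `σ` decays.

Potential. Take `V = σ`, `c = 2d` for BFGS and `V = tr(G - ∇²f)/μ ≥ σ`, `c = 2dϰ` for SR1. The
correction and the change of Hessian turn `V` into at most `(1 + Mλ)² (V + cMλ)` (`sigma_corr_le`,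
`trace_corr_le`). The update then subtracts the Rayleigh quotient of a positive semidefinite matrix
along the direction (`sigma_BFGS_le`, `trace_SR1_sub_le`). A greedy coordinate does at least as well
as the average `tr/d`, and an isotropic random direction attains that average in the mean, so the
update contracts the potential by `1 - 1/d`.

Closing the loop. Put `θ = V + cMλ`, `a = Mλ₀` and `t = a qᵏ`. Then `θ_{k+1} ≤ ((1 - 1/d)(1 + t)² +
ct) θ_k`. Since the `t` sum to at most `2ηa`, the initial condition makes the excess over `(1 -
1/d)ᵏ` at most a factor `2` (`le_of_contraction`). Finally `λ_{k+1} ≤ θ_k λ_k` multiplies out to the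
superlinear rate (`hasRates_of_theta_le`).

For random directions the factor multiplying `θ_k` is deterministic, because the linear rate holds
on every sample path; hence the recursion can be integrated (`expected_contraction`). Markov's
inequality and a union bound over `k` then cost a factor `d²/δ` and a slightly worse ratio
(`measure_geometric_tail_le`). -/

namespace QuasiNewton

/-! ### Quadratic forms, duality and traces in the Loewner order. -/

section LinearAlgebra

variable {d : ℕ} {A B D E G H K : Matrix (Fin d) (Fin d) ℝ}

theorem isHermitian_dotProduct_comm (hA : A.IsHermitian) (x y : Fin d → ℝ) :
    x ⬝ᵥ (A *ᵥ y) = y ⬝ᵥ (A *ᵥ x) := by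
  have h : Aᵀ = A := by simpa [Matrix.IsHermitian] using hA
  rw [dotProduct_mulVec, ← mulVec_transpose, h, dotProduct_comm]

theorem isHermitian_vecMul (hA : A.IsHermitian) (x : Fin d → ℝ) : x ᵥ* A = A *ᵥ x := by
  have h : Aᵀ = A := by simpa [Matrix.IsHermitian] using hA
  rw [← mulVec_transpose, h]

theorem quad_nonneg (hA : A.PosSemidef) (x : Fin d → ℝ) : 0 ≤ x ⬝ᵥ (A *ᵥ x) := by
  simpa using hA.dotProduct_mulVec_nonneg x

theorem quad_pos (hA : A.PosDef) {x : Fin d → ℝ} (hx : x ≠ 0) : 0 < x ⬝ᵥ (A *ᵥ x) := by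
  simpa using hA.dotProduct_mulVec_pos hx

theorem quad_smul (c : ℝ) (A : Matrix (Fin d) (Fin d) ℝ) (x y : Fin d → ℝ) :
    x ⬝ᵥ ((c • A) *ᵥ y) = c * (x ⬝ᵥ (A *ᵥ y)) := by
  simp [smul_mulVec]

theorem quad_sub (A B : Matrix (Fin d) (Fin d) ℝ) (x y : Fin d → ℝ) :
    x ⬝ᵥ ((A - B) *ᵥ y) = x ⬝ᵥ (A *ᵥ y) - x ⬝ᵥ (B *ᵥ y) := by
  simp [sub_mulVec]

theorem LoewnerLE.quad_le (h : LoewnerLE A B) (x : Fin d → ℝ) :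
    x ⬝ᵥ (A *ᵥ x) ≤ x ⬝ᵥ (B *ᵥ x) := by
  have := quad_nonneg h x
  rw [quad_sub] at this
  linarith

theorem loewnerLE_of_quad_le (hA : A.IsHermitian) (hB : B.IsHermitian)
    (h : ∀ x, x ⬝ᵥ (A *ᵥ x) ≤ x ⬝ᵥ (B *ᵥ x)) : LoewnerLE A B := by
  refine PosSemidef.of_dotProduct_mulVec_nonneg (hB.sub hA) fun x => ?_
  rw [star_trivial, quad_sub]
  linarith [h x]

theorem LoewnerLE.posDef (hA : A.PosDef) (h : LoewnerLE A B) : B.PosDef := by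
  have := PosDef.add_posSemidef hA h
  rwa [add_sub_cancel] at this

theorem isHermitian_smul (hA : A.IsHermitian) (c : ℝ) : (c • A).IsHermitian := by
  have h : Aᵀ = A := by simpa [Matrix.IsHermitian] using hA
  simp [Matrix.IsHermitian, h]

theorem quad_add_smul (hA : A.IsHermitian) (x y : Fin d → ℝ) (t : ℝ) :
    (x + t • y) ⬝ᵥ (A *ᵥ (x + t • y)) =
      x ⬝ᵥ (A *ᵥ x) + 2 * t * (x ⬝ᵥ (A *ᵥ y)) + t ^ 2 * (y ⬝ᵥ (A *ᵥ y)) := by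
  simp only [mulVec_add, mulVec_smul, dotProduct_add, add_dotProduct, smul_dotProduct,
    dotProduct_smul, smul_eq_mul, isHermitian_dotProduct_comm hA y x]
  ring

theorem quad_cauchy_schwarz (hA : A.PosSemidef) (x y : Fin d → ℝ) :
    (x ⬝ᵥ (A *ᵥ y)) ^ 2 ≤ (x ⬝ᵥ (A *ᵥ x)) * (y ⬝ᵥ (A *ᵥ y)) := by
  have h : ∀ t : ℝ, 0 ≤ (y ⬝ᵥ (A *ᵥ y)) * (t * t) + (2 * (x ⬝ᵥ (A *ᵥ y))) * t +
      x ⬝ᵥ (A *ᵥ x) := fun t => by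
    have := quad_nonneg hA (x + t • y)
    rw [quad_add_smul hA.1] at this
    linarith
  have := discrim_le_zero h
  rw [discrim] at this
  linarith

theorem mul_inv_of_posDef (hA : A.PosDef) : A * A⁻¹ = 1 :=
  mul_nonsing_inv _ ((isUnit_iff_isUnit_det _).1 hA.isUnit)

theorem inv_mul_of_posDef (hA : A.PosDef) : A⁻¹ * A = 1 :=
  nonsing_inv_mul _ ((isUnit_iff_isUnit_det _).1 hA.isUnit)

theorem mulVec_inv_mulVec (hA : A.PosDef) (x : Fin d → ℝ) : A *ᵥ (A⁻¹ *ᵥ x) = x := by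
  rw [mulVec_mulVec, mul_inv_of_posDef hA, one_mulVec]

theorem inv_mulVec_mulVec (hA : A.PosDef) (x : Fin d → ℝ) : A⁻¹ *ᵥ (A *ᵥ x) = x := by
  rw [mulVec_mulVec, inv_mul_of_posDef hA, one_mulVec]

/-- The Cauchy–Schwarz inequality between the norm of a positive definite matrix and its dual. -/
theorem dual_cauchy_schwarz (hA : A.PosDef) (x g : Fin d → ℝ) :
    (x ⬝ᵥ g) ^ 2 ≤ (x ⬝ᵥ (A *ᵥ x)) * (g ⬝ᵥ (A⁻¹ *ᵥ g)) := by
  have := quad_cauchy_schwarz hA.posSemidef x (A⁻¹ *ᵥ g)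
  rwa [mulVec_inv_mulVec hA, dotProduct_comm (A⁻¹ *ᵥ g)] at this

/-- Inversion reverses the order of positive definite quadratic forms. -/
theorem quad_inv_le (hA : A.PosDef) (hB : B.PosDef) {c : ℝ}
    (h : ∀ x, x ⬝ᵥ (A *ᵥ x) ≤ c * (x ⬝ᵥ (B *ᵥ x))) (g : Fin d → ℝ) :
    g ⬝ᵥ (B⁻¹ *ᵥ g) ≤ c * (g ⬝ᵥ (A⁻¹ *ᵥ g)) := by
  -- At `B⁻¹ g`, the form of `B` equals `gᵀB⁻¹g`, so `(gᵀB⁻¹g)² ≤ c (gᵀB⁻¹g)(gᵀA⁻¹g)`; one factor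
  -- cancels.
  have h1 := dual_cauchy_schwarz hA (B⁻¹ *ᵥ g) g
  have h2 := h (B⁻¹ *ᵥ g)
  rw [mulVec_inv_mulVec hB] at h2
  rw [dotProduct_comm (B⁻¹ *ᵥ g) g] at h1 h2
  have h3 := quad_nonneg hA.inv.posSemidef g
  have h4 := quad_nonneg hB.inv.posSemidef g
  rcases h4.eq_or_lt with h0 | h0
  · have h5 : g = 0 := by
      by_contra hg
      exact (quad_pos hB.inv hg).ne h0
    simp [h5]
  · have h5 := mul_le_mul_of_nonneg_right h2 h3
    nlinarith

theorem posSemidef_eq_sum (hD : D.PosSemidef) :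
    ∃ (m : ℕ) (v : Fin m → Fin d → ℝ), D = ∑ i, vecMulVec (v i) (v i) := by
  obtain ⟨m, v, hv⟩ := posSemidef_iff_eq_sum_vecMulVec.1 hD
  exact ⟨m, v, by simpa using hv⟩

theorem trace_vecMulVec_mul (a b : Fin d → ℝ) (E : Matrix (Fin d) (Fin d) ℝ) :
    (vecMulVec a b * E).trace = b ⬝ᵥ (E *ᵥ a) := by
  rw [vecMulVec_mul, trace_vecMulVec, dotProduct_comm, dotProduct_mulVec]

theorem quad_vecMulVec (a b x y : Fin d → ℝ) :
    x ⬝ᵥ (vecMulVec a b *ᵥ y) = (x ⬝ᵥ a) * (b ⬝ᵥ y) := by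
  rw [vecMulVec_mulVec]
  simp [dotProduct_smul, mul_comm]

theorem trace_mul_nonneg (hD : D.PosSemidef) (hE : E.PosSemidef) : 0 ≤ (D * E).trace := by
  obtain ⟨m, v, rfl⟩ := posSemidef_eq_sum hD
  rw [Finset.sum_mul, trace_sum]
  exact Finset.sum_nonneg fun i _ => by
    rw [trace_vecMulVec_mul]; exact quad_nonneg hE _

/-- Writing `D` as a sum of `v vᵀ`, each term satisfies `(xᵀv)² ≤ (xᵀAx)(vᵀA⁻¹v)`. This is how `σ`
controls `G` from above: `G ⪯ (1 + σ)A`. -/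
theorem quad_le_trace_mul_inv (hA : A.PosDef) (hD : D.PosSemidef) (x : Fin d → ℝ) :
    x ⬝ᵥ (D *ᵥ x) ≤ (D * A⁻¹).trace * (x ⬝ᵥ (A *ᵥ x)) := by
  obtain ⟨m, v, rfl⟩ := posSemidef_eq_sum hD
  rw [Finset.sum_mul, trace_sum, sum_mulVec, dotProduct_sum, Finset.sum_mul]
  refine Finset.sum_le_sum fun i _ => ?_
  rw [trace_vecMulVec_mul, quad_vecMulVec, dotProduct_comm (v i) x, ← pow_two, mul_comm]
  exact dual_cauchy_schwarz hA x (v i)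

theorem trace_mul_le (hD : D.PosSemidef) (hA : A.IsHermitian) (hB : B.IsHermitian)
    (h : ∀ x, x ⬝ᵥ (A *ᵥ x) ≤ x ⬝ᵥ (B *ᵥ x)) : (D * A).trace ≤ (D * B).trace := by
  have := trace_mul_nonneg hD (loewnerLE_of_quad_le hA hB h)
  rw [mul_sub, trace_sub] at this
  linarith

theorem trace_eq_sum_quad (B : Matrix (Fin d) (Fin d) ℝ) :
    B.trace = ∑ i, (Pi.single i 1 : Fin d → ℝ) ⬝ᵥ (B *ᵥ Pi.single i 1) := by
  simp [Matrix.trace]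

theorem trace_le_of_quad_le (h : ∀ x, x ⬝ᵥ (A *ᵥ x) ≤ x ⬝ᵥ (B *ᵥ x)) : A.trace ≤ B.trace := by
  rw [trace_eq_sum_quad, trace_eq_sum_quad]
  exact Finset.sum_le_sum fun i _ => h _

/-- Cauchy–Schwarz on coordinate vectors gives `B i j ^ 2 ≤ B i i * B j j`. The bound makes the
entries of a random matrix integrable as soon as its trace is. -/
theorem abs_apply_le_trace (hB : B.PosSemidef) (i j : Fin d) : |B i j| ≤ B.trace := by
  have hdiag : ∀ i, B i i ≤ B.trace := fun i =>
    Finset.single_le_sum (f := fun i => B i i) (fun i _ => hB.diag_nonneg) (Finset.mem_univ i)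
  have h := quad_cauchy_schwarz hB (Pi.single i 1) (Pi.single j 1)
  simp only [mulVec_single_one, single_one_dotProduct, col_apply] at h
  refine abs_le_of_sq_le_sq (h.trans ?_) (hB.trace_nonneg)
  rw [pow_two]
  exact mul_le_mul (hdiag i) (hdiag j) hB.diag_nonneg hB.trace_nonneg

/-- A coordinate vector maximizing a quadratic form exceeds the average over the coordinates. -/
theorem IsCoordArgmax.trace_le {u : Fin d → ℝ} (h : IsCoordArgmax B u) :
    u ⬝ᵥ u = 1 ∧ B.trace ≤ d * (u ⬝ᵥ (B *ᵥ u)) := by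
  obtain ⟨i, rfl, h⟩ := h
  refine ⟨by simp, ?_⟩
  rw [trace_eq_sum_quad]
  refine (Finset.sum_le_sum fun j _ => h j).trans ?_
  rw [Finset.sum_const, Finset.card_univ, Fintype.card_fin, nsmul_eq_mul]

/-- If `p G ⪯ H ⪯ q G`, then `(H - p G) H⁻¹ (q G - H)` is positive semidefinite. -/
theorem commuting_product_nonneg (hH : H.PosDef) (hG : G.IsHermitian) {p q : ℝ} (hp : 0 ≤ p)
    (hpq : p < q) (h1 : ∀ x, p * (x ⬝ᵥ (G *ᵥ x)) ≤ x ⬝ᵥ (H *ᵥ x))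
    (h2 : ∀ x, x ⬝ᵥ (H *ᵥ x) ≤ q * (x ⬝ᵥ (G *ᵥ x))) (h : Fin d → ℝ) :
    0 ≤ ((H - p • G) *ᵥ h) ⬝ᵥ (H⁻¹ *ᵥ ((q • G - H) *ᵥ h)) := by
  set X := H - p • G with hX
  set Y := q • G - H with hY
  have hXs : X.IsHermitian := hH.1.sub (isHermitian_smul hG p)
  set a := H⁻¹ *ᵥ (X *ᵥ h) with ha
  set b := H⁻¹ *ᵥ (Y *ᵥ h) with hb
  have hHa : H *ᵥ a = X *ᵥ h := mulVec_inv_mulVec hH _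
  have hHb : H *ᵥ b = Y *ᵥ h := mulVec_inv_mulVec hH _
  have hab : q • a + p • b = (q - p) • h := by
    -- `qX + pY = (q - p)H`, which expresses `h` through `a` and `b`.
    have e : q • (X *ᵥ h) + p • (Y *ᵥ h) = H *ᵥ ((q - p) • h) := by
      simp only [hX, hY, sub_mulVec, smul_mulVec, mulVec_smul]
      module
    have e' : H⁻¹ *ᵥ (q • (X *ᵥ h) + p • (Y *ᵥ h)) = q • a + p • b := by
      rw [mulVec_add, mulVec_smul, mulVec_smul]
    rw [← e', e, inv_mulVec_mulVec hH]
  -- This says `X H⁻¹ Y = Y H⁻¹ X`: `X` and `Y` lie in the pencil of `G` and `H`, so no spectral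
  -- decomposition is needed.
  have hcomm : X *ᵥ b = Y *ᵥ a := by
    have e : G *ᵥ (q • a + p • b) = X *ᵥ h + Y *ᵥ h := by
      rw [hab]
      simp only [hX, hY, sub_mulVec, smul_mulVec, mulVec_smul]
      module
    have e2 : X *ᵥ b - Y *ᵥ a = H *ᵥ b + H *ᵥ a - G *ᵥ (q • a + p • b) := by
      simp only [hX, hY, sub_mulVec, smul_mulVec, mulVec_smul, mulVec_add]
      module
    rw [← sub_eq_zero, e2, e, hHa, hHb]
    module
  have hfin : (q - p) * ((X *ᵥ h) ⬝ᵥ b) = q * (a ⬝ᵥ (Y *ᵥ a)) + p * (b ⬝ᵥ (X *ᵥ b)) := by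
    rw [← smul_eq_mul, ← smul_dotProduct, ← mulVec_smul, ← hab, dotProduct_comm, mulVec_add,
      mulVec_smul, mulVec_smul, dotProduct_add, dotProduct_smul, dotProduct_smul,
      isHermitian_dotProduct_comm hXs b a, hcomm]
    simp
  have h3 : 0 ≤ a ⬝ᵥ (Y *ᵥ a) := by
    rw [hY, quad_sub, quad_smul]; linarith [h2 a]
  have h4 : 0 ≤ b ⬝ᵥ (X *ᵥ b) := by
    rw [hX, quad_sub, quad_smul]; linarith [h1 b]
  have h5 : 0 ≤ (q - p) * ((X *ᵥ h) ⬝ᵥ b) := by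
    rw [hfin]
    exact add_nonneg (mul_nonneg (hp.trans hpq.le) h3) (mul_nonneg hp h4)
  exact nonneg_of_mul_nonneg_right h5 (sub_pos.2 hpq)

/-- If `(1 - ρ) G ⪯ H ⪯ (1 + ρ) G`, then `H - G` is small compared with `G`, in the norms
of `H` and `H⁻¹`. -/
theorem sq_dotProduct_sub_le (hH : H.PosDef) (hG : G.IsHermitian) {ρ : ℝ} (hρ : 0 ≤ ρ)
    (hρ1 : ρ ≤ 1) (h1 : ∀ x, (1 - ρ) * (x ⬝ᵥ (G *ᵥ x)) ≤ x ⬝ᵥ (H *ᵥ x))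
    (h2 : ∀ x, x ⬝ᵥ (H *ᵥ x) ≤ (1 + ρ) * (x ⬝ᵥ (G *ᵥ x))) (y h : Fin d → ℝ) :
    (y ⬝ᵥ ((H - G) *ᵥ h)) ^ 2 ≤
      (y ⬝ᵥ (H *ᵥ y)) * (ρ ^ 2 * ((G *ᵥ h) ⬝ᵥ (H⁻¹ *ᵥ (G *ᵥ h)))) := by
  -- For `ρ = 0` the two bounds coincide and force `H = G`; the product lemma needs `1 - ρ < 1 + ρ`.
  rcases hρ.eq_or_lt with rfl | hρ
  · have h3 := quad_cauchy_schwarz (loewnerLE_of_quad_le hG hH.1 (by simpa using h1)) y h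
    have h4 : h ⬝ᵥ ((H - G) *ᵥ h) = 0 := by
      rw [quad_sub]; linarith [h1 h, h2 h]
    simpa [h4] using h3
  -- With `p = 1 - ρ` and `q = 1 + ρ` the product expands to `2G - H - (1 - ρ²) G H⁻¹ G`, so its
  -- nonnegativity is `(H - G)H⁻¹(H - G) ⪯ ρ² G H⁻¹ G`.
  have h3 := commuting_product_nonneg hH hG (by linarith) (by linarith) h1 h2 h
  refine (dual_cauchy_schwarz hH y _).trans ?_
  refine mul_le_mul_of_nonneg_left ?_ (quad_nonneg hH.posSemidef y)
  have e1 : (H *ᵥ h) ⬝ᵥ (H⁻¹ *ᵥ (G *ᵥ h)) = h ⬝ᵥ (G *ᵥ h) := by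
    rw [isHermitian_dotProduct_comm hH.inv.1, inv_mulVec_mulVec hH, dotProduct_comm]
  simp only [sub_mulVec, smul_mulVec, mulVec_sub, mulVec_smul, dotProduct_sub, sub_dotProduct,
    smul_dotProduct, dotProduct_smul, smul_eq_mul, inv_mulVec_mulVec hH, e1,
    dotProduct_comm (G *ᵥ h) h, dotProduct_comm (H *ᵥ h) h] at h3 ⊢
  linarith

end LinearAlgebra

/-! ### The BFGS and SR1 updates: order bounds, factors and decrease. -/

section Updates

variable {d : ℕ} {A G K : Matrix (Fin d) (Fin d) ℝ}

/-- Schur complements of quadratic forms along a vector are monotone. -/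
theorem schur_quad_le {A B : Matrix (Fin d) (Fin d) ℝ} (hA : A.PosDef) (hB : B.PosDef) {c : ℝ}
    (h : ∀ x, x ⬝ᵥ (A *ᵥ x) ≤ c * (x ⬝ᵥ (B *ᵥ x))) (u x : Fin d → ℝ) :
    x ⬝ᵥ (A *ᵥ x) - (u ⬝ᵥ (A *ᵥ u))⁻¹ * (x ⬝ᵥ (A *ᵥ u)) ^ 2 ≤
      c * (x ⬝ᵥ (B *ᵥ x) - (u ⬝ᵥ (B *ᵥ u))⁻¹ * (x ⬝ᵥ (B *ᵥ u)) ^ 2) := by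
  rcases eq_or_ne u 0 with rfl | hu
  · simpa using h x
  have hα := quad_pos hA hu
  have hβ := quad_pos hB hu
  set α := u ⬝ᵥ (A *ᵥ u)
  set β := u ⬝ᵥ (B *ᵥ u)
  set a := x ⬝ᵥ (A *ᵥ u)
  set b := x ⬝ᵥ (B *ᵥ u)
  -- The Schur complement is the minimum of the form over `x + t u`. The point chosen is the
  -- minimizer for `B`; the form of `A` there is at least its own minimum.
  have h1 := h (x + (-(β⁻¹ * b)) • u)
  rw [quad_add_smul hA.1, quad_add_smul hB.1] at h1
  have e : x ⬝ᵥ (B *ᵥ x) + 2 * (-(β⁻¹ * b)) * b + (-(β⁻¹ * b)) ^ 2 * β =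
      x ⬝ᵥ (B *ᵥ x) - β⁻¹ * b ^ 2 := by
    field_simp
    ring
  rw [e] at h1
  refine le_trans ?_ h1
  have e2 : 2 * (-(β⁻¹ * b)) * a + (-(β⁻¹ * b)) ^ 2 * α + α⁻¹ * a ^ 2 =
      α⁻¹ * (a - β⁻¹ * b * α) ^ 2 := by
    field_simp
    ring
  have : 0 ≤ α⁻¹ * (a - β⁻¹ * b * α) ^ 2 := by positivity
  linarith

theorem BFGS_eq (hG : G.IsHermitian) (hA : A.IsHermitian) (u : Fin d → ℝ) :
    BFGS G A u = G - (u ⬝ᵥ (G *ᵥ u))⁻¹ • vecMulVec (G *ᵥ u) (G *ᵥ u) +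
      (u ⬝ᵥ (A *ᵥ u))⁻¹ • vecMulVec (A *ᵥ u) (A *ᵥ u) := by
  rw [BFGS, isHermitian_vecMul hG, isHermitian_vecMul hA]

theorem isHermitian_vecMulVec_self (a : Fin d → ℝ) : (vecMulVec a a).IsHermitian := by
  ext i j; simp [vecMulVec_apply, mul_comm]

theorem isHermitian_BFGS (hG : G.IsHermitian) (hA : A.IsHermitian) (u : Fin d → ℝ) :
    (BFGS G A u).IsHermitian := by
  rw [BFGS_eq hG hA]
  exact (hG.sub (isHermitian_smul (isHermitian_vecMulVec_self _) _)).add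
    (isHermitian_smul (isHermitian_vecMulVec_self _) _)

theorem quad_BFGS (hG : G.IsHermitian) (hA : A.IsHermitian) (u x : Fin d → ℝ) :
    x ⬝ᵥ (BFGS G A u *ᵥ x) = x ⬝ᵥ (G *ᵥ x) - (u ⬝ᵥ (G *ᵥ u))⁻¹ * (x ⬝ᵥ (G *ᵥ u)) ^ 2 +
      (u ⬝ᵥ (A *ᵥ u))⁻¹ * (x ⬝ᵥ (A *ᵥ u)) ^ 2 := by
  rw [BFGS_eq hG hA, add_mulVec, dotProduct_add, quad_sub, quad_smul, quad_smul, quad_vecMulVec,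
    quad_vecMulVec, dotProduct_comm (G *ᵥ u) x, dotProduct_comm (A *ᵥ u) x, pow_two, pow_two]

/-- The BFGS update preserves two-sided bounds relative to the target matrix. -/
theorem BFGS_bounds (hA : A.PosDef) {c : ℝ} (hc : 1 ≤ c) (h1 : LoewnerLE A G)
    (h2 : LoewnerLE G (c • A)) (u : Fin d → ℝ) :
    LoewnerLE A (BFGS G A u) ∧ LoewnerLE (BFGS G A u) (c • A) := by
  have hG := h1.posDef hA
  have hB := isHermitian_BFGS hG.1 hA.1 u
  have hα : 0 ≤ (u ⬝ᵥ (A *ᵥ u))⁻¹ := inv_nonneg.2 (quad_nonneg hA.posSemidef u)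
  refine ⟨loewnerLE_of_quad_le hA.1 hB fun x => ?_,
    loewnerLE_of_quad_le hB (isHermitian_smul hA.1 c) fun x => ?_⟩
  -- The BFGS form is the Schur complement of `G` plus the part of `A` along `u`, and `A` itself
  -- splits in the same way. In the upper bound, `1 ≤ c` handles the part along `u`.
  · have := schur_quad_le hA hG (c := 1) (fun x => by simpa using h1.quad_le x) u x
    rw [quad_BFGS hG.1 hA.1]
    linarith
  · have := schur_quad_le hG hA (c := c) (fun x => by simpa [quad_smul] using h2.quad_le x) u x
    rw [quad_BFGS hG.1 hA.1, quad_smul]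
    have h4 : 0 ≤ (c - 1) * ((u ⬝ᵥ (A *ᵥ u))⁻¹ * (x ⬝ᵥ (A *ᵥ u)) ^ 2) :=
      mul_nonneg (by linarith) (by positivity)
    linarith

theorem sigma_eq (hA : A.PosDef) : sigma A G = (G * A⁻¹).trace - d := by
  rw [sigma, sub_mul, mul_inv_of_posDef hA, trace_sub, trace_one, Fintype.card_fin]

/-- The last term is left as `a⁻¹ * a` so that `u = 0` is covered: it is `1` for `u ≠ 0` and `0`
otherwise. -/
theorem sigma_BFGS (hG : G.IsHermitian) (hA : A.PosDef) (u : Fin d → ℝ) :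
    sigma A (BFGS G A u) = sigma A G - (u ⬝ᵥ (G *ᵥ u))⁻¹ * ((G *ᵥ u) ⬝ᵥ (A⁻¹ *ᵥ (G *ᵥ u))) +
      (u ⬝ᵥ (A *ᵥ u))⁻¹ * (u ⬝ᵥ (A *ᵥ u)) := by
  rw [sigma_eq hA, sigma_eq hA, BFGS_eq hG hA.1, add_mul, sub_mul, trace_add, trace_sub,
    smul_mul_assoc, smul_mul_assoc, trace_smul, trace_smul, trace_vecMulVec_mul,
    trace_vecMulVec_mul, inv_mulVec_mulVec hA, dotProduct_comm (A *ᵥ u) u, smul_eq_mul,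
    smul_eq_mul]
  ring

theorem isUnit_det_of_factor (hG : G.PosDef) (hK : Kᵀ * K = G⁻¹) : IsUnit K.det := by
  have h : IsUnit (G⁻¹).det := (isUnit_iff_isUnit_det _).1 hG.inv.isUnit
  rw [← hK, det_mul] at h
  exact isUnit_of_mul_isUnit_right h

theorem eq_inv_mul_inv_transpose (hG : G.PosDef) (hK : Kᵀ * K = G⁻¹) : G = K⁻¹ * (K⁻¹)ᵀ := by
  have h : G⁻¹⁻¹ = G := nonsing_inv_nonsing_inv _ ((isUnit_iff_isUnit_det _).1 hG.isUnit)
  rw [← h, ← hK, Matrix.mul_inv_rev, transpose_nonsing_inv]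

/-- Since `G = K⁻¹K⁻ᵀ`, scaling the direction by `Kᵀ` turns the `G`-norm into the Euclidean norm of
`w`. The decrease of `σ` thus becomes an ordinary Rayleigh quotient in `w`, to which averaging over
coordinates or isotropic laws applies. -/
theorem mulVec_transpose_factor (hG : G.PosDef) (hK : Kᵀ * K = G⁻¹) (w : Fin d → ℝ) :
    G *ᵥ (Kᵀ *ᵥ w) = K⁻¹ *ᵥ w := by
  have hu := isUnit_det_of_factor hG hK
  have h1 : (K⁻¹)ᵀ * Kᵀ = 1 := by rw [← transpose_mul, mul_nonsing_inv _ hu, transpose_one]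
  rw [mulVec_mulVec, eq_inv_mul_inv_transpose hG hK, Matrix.mul_assoc, h1, Matrix.mul_one]

theorem quad_transpose_factor (hG : G.PosDef) (hK : Kᵀ * K = G⁻¹) (w : Fin d → ℝ) :
    (Kᵀ *ᵥ w) ⬝ᵥ (G *ᵥ (Kᵀ *ᵥ w)) = w ⬝ᵥ w := by
  rw [mulVec_transpose_factor hG hK, mulVec_transpose, ← dotProduct_mulVec, mulVec_mulVec,
    mul_nonsing_inv _ (isUnit_det_of_factor hG hK), one_mulVec]

theorem quad_scaled (K A : Matrix (Fin d) (Fin d) ℝ) (w : Fin d → ℝ) :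
    w ⬝ᵥ (((K⁻¹)ᵀ * A⁻¹ * K⁻¹) *ᵥ w) = (K⁻¹ *ᵥ w) ⬝ᵥ (A⁻¹ *ᵥ (K⁻¹ *ᵥ w)) := by
  rw [← mulVec_mulVec, ← mulVec_mulVec, dotProduct_mulVec, vecMul_transpose]

theorem posSemidef_scaled (hA : A.PosDef) (K : Matrix (Fin d) (Fin d) ℝ) :
    ((K⁻¹)ᵀ * A⁻¹ * K⁻¹).PosSemidef := by
  simpa using hA.inv.posSemidef.conjTranspose_mul_mul_same K⁻¹

theorem trace_scaled (hG : G.PosDef) (hA : A.PosDef) (hK : Kᵀ * K = G⁻¹) :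
    ((K⁻¹)ᵀ * A⁻¹ * K⁻¹).trace = sigma A G + d := by
  rw [sigma_eq hA, sub_add_cancel, Matrix.mul_assoc, trace_mul_comm, Matrix.mul_assoc,
    ← eq_inv_mul_inv_transpose hG hK, trace_mul_comm]

/-- The decrease of `σ` under a BFGS update along the scaled direction `Kᵀ w`. -/
theorem sigma_BFGS_le (hG : G.PosDef) (hA : A.PosDef) (hK : Kᵀ * K = G⁻¹) (w : Fin d → ℝ) :
    sigma A (BFGS G A (Kᵀ *ᵥ w)) ≤
      sigma A G + 1 - (w ⬝ᵥ w)⁻¹ * (w ⬝ᵥ (((K⁻¹)ᵀ * A⁻¹ * K⁻¹) *ᵥ w)) := by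
  rw [sigma_BFGS hG.1 hA, quad_transpose_factor hG hK, mulVec_transpose_factor hG hK, quad_scaled]
  have h : ∀ a : ℝ, a⁻¹ * a ≤ 1 := fun a => by
    rcases eq_or_ne a 0 with rfl | ha
    · simp
    · rw [inv_mul_cancel₀ ha]
  linarith [h ((Kᵀ *ᵥ w) ⬝ᵥ (A *ᵥ (Kᵀ *ᵥ w)))]

/-- The updated factor factorizes the inverse of the BFGS update. -/
theorem factorUpdate_transpose_mul (hG : G.PosDef) (hA : A.PosDef) (hK : Kᵀ * K = G⁻¹)
    (w : Fin d → ℝ) :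
    (factorUpdate K A w)ᵀ * factorUpdate K A w = (BFGS G A (Kᵀ *ᵥ w))⁻¹ := by
  rcases eq_or_ne w 0 with rfl | hw
  · simp [factorUpdate, BFGS, hK]
  set u := Kᵀ *ᵥ w with hu
  have hww : 0 < w ⬝ᵥ w := by simpa using dotProduct_star_self_pos_iff.2 hw
  have hu0 : u ≠ 0 := by
    intro h
    have := quad_transpose_factor hG hK w
    rw [← hu, h] at this
    simp at this
    exact hww.ne this
  have hα := quad_pos hG hu0
  have hβ := quad_pos hA hu0
  set α := u ⬝ᵥ (G *ᵥ u) with hα'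
  set β := u ⬝ᵥ (A *ᵥ u) with hβ'
  set c := weightedNorm A u / √(w ⬝ᵥ w) with hc
  have hcc : c ^ 2 * (w ⬝ᵥ w) = β := by
    rw [hc, div_pow, weightedNorm, Real.sq_sqrt hβ.le, Real.sq_sqrt hww.le]
    field_simp
  symm
  -- With `F` the updated factor, it suffices that the BFGS matrix sends `y = FᵀF x` back to `x` for
  -- each coordinate vector `x`.
  refine inv_eq_right_inv (Matrix.ext_of_mulVec_single fun i => ?_)
  generalize (Pi.single i 1 : Fin d → ℝ) = x
  rw [one_mulVec, ← mulVec_mulVec, ← mulVec_mulVec]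
  set b := K *ᵥ (A *ᵥ u) - c • w with hb
  have hKw : ∀ y, w ⬝ᵥ (K *ᵥ y) = u ⬝ᵥ y := fun y => by
    rw [dotProduct_mulVec, hu, mulVec_transpose]
  have hF : factorUpdate K A w = K - β⁻¹ • vecMulVec b u := rfl
  set s := β⁻¹ * (u ⬝ᵥ x) with hs
  have hsβ : s * β = u ⬝ᵥ x := by rw [hs]; field_simp
  obtain ⟨z, hz⟩ : ∃ z, z = factorUpdate K A w *ᵥ x := ⟨_, rfl⟩
  have hz' : z = K *ᵥ x - s • b := by
    rw [hz, hF, sub_mulVec, smul_mulVec, vecMulVec_mulVec, hs]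
    simp [smul_smul]
  obtain ⟨y, hy⟩ : ∃ y, y = (factorUpdate K A w)ᵀ *ᵥ z := ⟨_, rfl⟩
  have hy' : y = Kᵀ *ᵥ z - (β⁻¹ * (b ⬝ᵥ z)) • u := by
    rw [hy, hF, transpose_sub, transpose_smul, transpose_vecMulVec, sub_mulVec, smul_mulVec,
      vecMulVec_mulVec]
    simp [smul_smul]
  rw [← hz, ← hy]
  have hwz : c * (w ⬝ᵥ z) = u ⬝ᵥ x := by
    rw [hz', hb, dotProduct_sub, dotProduct_smul, dotProduct_sub, hKw, hKw, dotProduct_smul]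
    simp only [smul_eq_mul]
    rw [← hβ']
    linear_combination s * hcc + (1 - c) * hsβ
  have hAy : (A *ᵥ u) ⬝ᵥ y = u ⬝ᵥ x := by
    rw [hy', dotProduct_sub, dotProduct_smul, dotProduct_comm (A *ᵥ u) u, ← hβ', mulVec_transpose,
      dotProduct_comm (A *ᵥ u), ← dotProduct_mulVec, smul_eq_mul, mul_right_comm,
      inv_mul_cancel₀ hβ.ne', one_mul, hb, sub_dotProduct, smul_dotProduct, smul_eq_mul, hwz,
      dotProduct_comm z]
    ring
  -- The value of `τ` is irrelevant: the rank-one term in `G u` removes `τ G u`, and the one in `A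
  -- u` restores `s A u`.
  obtain ⟨τ, hτ⟩ : ∃ τ : ℝ, y = G⁻¹ *ᵥ x - s • (G⁻¹ *ᵥ (A *ᵥ u)) + τ • u := by
    refine ⟨s * c - β⁻¹ * (b ⬝ᵥ z), ?_⟩
    rw [hy', hz', hb, mulVec_sub, mulVec_smul, mulVec_sub, mulVec_smul, mulVec_mulVec,
      mulVec_mulVec, hK, ← hu]
    module
  have hGy : G *ᵥ y = x - s • (A *ᵥ u) + τ • (G *ᵥ u) := by
    rw [hτ, mulVec_add, mulVec_sub, mulVec_smul, mulVec_smul, mulVec_inv_mulVec hG,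
      mulVec_inv_mulVec hG]
  have hGuy : (G *ᵥ u) ⬝ᵥ y = τ * α := by
    rw [dotProduct_comm, isHermitian_dotProduct_comm hG.1, hGy, dotProduct_add, dotProduct_sub,
      dotProduct_smul, dotProduct_smul, ← hβ', ← hα', smul_eq_mul, smul_eq_mul, hsβ]
    ring
  rw [BFGS_eq hG.1 hA.1, add_mulVec, sub_mulVec, smul_mulVec, smul_mulVec, vecMulVec_mulVec,
    vecMulVec_mulVec, hGuy, hAy, hGy, ← hα', ← hβ', op_smul_eq_smul, op_smul_eq_smul, smul_smul,
    smul_smul, ← hs, show α⁻¹ * (τ * α) = τ by field_simp]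
  module

/-- When `G u = A u` the rank-one term vanishes, so a single formula covers both cases. This serves
the algebra and the measurability of the update. -/
theorem SR1_eq (G A : Matrix (Fin d) (Fin d) ℝ) (u : Fin d → ℝ) :
    SR1 G A u = G - (u ⬝ᵥ ((G - A) *ᵥ u))⁻¹ • vecMulVec ((G - A) *ᵥ u) (u ᵥ* (G - A)) := by
  rw [SR1]
  split_ifs with h
  · simp [sub_mulVec, h]
  · rfl

theorem SR1_sub_eq (hD : (G - A).IsHermitian) (u : Fin d → ℝ) :
    SR1 G A u - A = (G - A) -
      (u ⬝ᵥ ((G - A) *ᵥ u))⁻¹ • vecMulVec ((G - A) *ᵥ u) ((G - A) *ᵥ u) := by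
  rw [SR1_eq, isHermitian_vecMul hD]
  abel

theorem quad_SR1_sub (hD : (G - A).IsHermitian) (u x : Fin d → ℝ) :
    x ⬝ᵥ ((SR1 G A u - A) *ᵥ x) = x ⬝ᵥ ((G - A) *ᵥ x) -
      (u ⬝ᵥ ((G - A) *ᵥ u))⁻¹ * (x ⬝ᵥ ((G - A) *ᵥ u)) ^ 2 := by
  rw [SR1_sub_eq hD, quad_sub, quad_smul, quad_vecMulVec, dotProduct_comm ((G - A) *ᵥ u) x, pow_two]

/-- The SR1 update preserves two-sided bounds relative to the target matrix. -/
theorem SR1_bounds (hA : A.PosDef) {c : ℝ} (h1 : LoewnerLE A G) (h2 : LoewnerLE G (c • A))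
    (u : Fin d → ℝ) : LoewnerLE A (SR1 G A u) ∧ LoewnerLE (SR1 G A u) (c • A) := by
  have hS : (SR1 G A u - A).IsHermitian := by
    rw [SR1_sub_eq h1.1]
    exact h1.1.sub (isHermitian_smul (isHermitian_vecMulVec_self _) _)
  have hS' : (SR1 G A u).IsHermitian := by simpa using hS.add hA.1
  have hα := quad_nonneg h1 u
  constructor
  · refine PosSemidef.of_dotProduct_mulVec_nonneg hS fun x => ?_
    rw [star_trivial, quad_SR1_sub h1.1]
    have hcs := quad_cauchy_schwarz h1 x u
    rcases hα.eq_or_lt with h0 | h0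
    · rw [← h0]
      simpa using quad_nonneg h1 x
    · rw [sub_nonneg, inv_mul_le_iff₀ h0, mul_comm]
      exact hcs
  · refine loewnerLE_of_quad_le hS' (isHermitian_smul hA.1 c) fun x => ?_
    refine le_trans ?_ (h2.quad_le x)
    have h3 := quad_SR1_sub h1.1 u x
    rw [quad_sub, quad_sub G A x x] at h3
    have : 0 ≤ (u ⬝ᵥ ((G - A) *ᵥ u))⁻¹ * (x ⬝ᵥ ((G - A) *ᵥ u)) ^ 2 := by positivity
    linarith

/-- The decrease of `tr (G - A)` under an SR1 update. -/
theorem trace_SR1_sub_le (h1 : LoewnerLE A G) (u : Fin d → ℝ) :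
    (SR1 G A u - A).trace ≤ (G - A).trace - (u ⬝ᵥ u)⁻¹ * (u ⬝ᵥ ((G - A) *ᵥ u)) := by
  rw [SR1_sub_eq h1.1, trace_sub, trace_smul, trace_vecMulVec, smul_eq_mul]
  refine sub_le_sub_left ?_ _
  set v := (G - A) *ᵥ u
  rcases (quad_nonneg h1 u).eq_or_lt with h0 | h0
  · change 0 = u ⬝ᵥ v at h0
    simp [← h0]
  · change 0 < u ⬝ᵥ v at h0
    -- With `v = (G - A)u`, the actual decrease is `|v|²/(uᵀv)`; Cauchy–Schwarz `(uᵀv)² ≤ |u|²|v|²`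
    -- bounds it below by the Rayleigh quotient `uᵀv/|u|²`.
    have hcs := quad_cauchy_schwarz (PosSemidef.one (n := Fin d) (R := ℝ)) u v
    rw [one_mulVec, one_mulVec] at hcs
    have hu : 0 < u ⬝ᵥ u := by
      have : u ≠ 0 := by rintro rfl; simp at h0
      simpa using dotProduct_star_self_pos_iff.2 this
    rw [inv_mul_le_iff₀ hu, ← mul_assoc, mul_comm (u ⬝ᵥ u), mul_assoc, le_inv_mul_iff₀ h0]
    linarith

end Updates

/-! ### One quasi-Newton step: the decrease of the Newton decrement. -/

section Decrement

variable {d : ℕ} {f : (Fin d → ℝ) → ℝ} {M μ L : ℝ}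

theorem fderiv_eq_dotProduct (f : (Fin d → ℝ) → ℝ) (x y : Fin d → ℝ) :
    fderiv ℝ f x y = y ⬝ᵥ grad f x := by
  conv_lhs => rw [pi_eq_sum_univ' y]
  simp [dotProduct, grad]

theorem fderiv_fderiv_eq_dotProduct (f : (Fin d → ℝ) → ℝ) (x h y : Fin d → ℝ) :
    fderiv ℝ (fderiv ℝ f) x h y = h ⬝ᵥ (hess f x *ᵥ y) := by
  conv_lhs => rw [pi_eq_sum_univ' h, pi_eq_sum_univ' y]
  simp only [map_sum, map_smul, dotProduct, mulVec, hess, of_apply, smul_eq_mul,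
    FunLike.coe_sum, Finset.sum_apply, FunLike.coe_smul, Pi.smul_apply, Finset.mul_sum]
  rw [Finset.sum_comm]
  exact Finset.sum_congr rfl fun i _ => Finset.sum_congr rfl fun j _ => by ring

/-- The mean value theorem for the gradient in a fixed dual direction. -/
theorem exists_hess_eq_grad_sub (hf : TwiceDifferentiable f) (hs : ∀ x, (hess f x).IsHermitian)
    (x h y : Fin d → ℝ) :
    ∃ t ∈ Set.Ioo (0 : ℝ) 1,
      y ⬝ᵥ grad f (x + h) - y ⬝ᵥ grad f x = y ⬝ᵥ (hess f (x + t • h) *ᵥ h) := by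
  have hd : ∀ t : ℝ, HasDerivAt (fun t : ℝ => fderiv ℝ f (x + t • h) y)
      (y ⬝ᵥ (hess f (x + t • h) *ᵥ h)) t := fun t => by
    have h1 : HasDerivAt (fun t : ℝ => x + t • h) h t := by
      simpa using ((hasDerivAt_id t).smul_const h).const_add x
    have h2 : HasDerivAt (fun t : ℝ => fderiv ℝ f (x + t • h))
        (fderiv ℝ (fderiv ℝ f) (x + t • h) h) t :=
      (hf.2 (x + t • h)).hasFDerivAt.comp_hasDerivAt t h1
    have h3 := (ContinuousLinearMap.apply ℝ ℝ y).hasFDerivAt.comp_hasDerivAt t h2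
    rw [isHermitian_dotProduct_comm (hs _) y h, ← fderiv_fderiv_eq_dotProduct]
    exact h3
  obtain ⟨t, ht, e⟩ := exists_hasDerivAt_eq_slope (fun t : ℝ => fderiv ℝ f (x + t • h) y) _
    zero_lt_one (fun t _ => (hd t).continuousAt.continuousWithinAt) (fun t _ => hd t)
  refine ⟨t, ht, ?_⟩
  rw [e]
  simp [fderiv_eq_dotProduct]

/-- Symmetry of the Hessian comes from the Loewner lower bound, with no appeal to the symmetry of
second derivatives. -/
theorem StronglyConvexSmooth.posDef_hess (hf : StronglyConvexSmooth μ L f) (x : Fin d → ℝ) :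
    (hess f x).PosDef :=
  (hf.lower x).posDef (PosDef.one.smul hf.convexity_pos)

theorem weightedNorm_nonneg (A : Matrix (Fin d) (Fin d) ℝ) (v : Fin d → ℝ) :
    0 ≤ weightedNorm A v := Real.sqrt_nonneg _

theorem weightedNorm_smul (A : Matrix (Fin d) (Fin d) ℝ) (v : Fin d → ℝ) {t : ℝ} (ht : 0 ≤ t) :
    weightedNorm A (t • v) = t * weightedNorm A v := by
  rw [weightedNorm, mulVec_smul, dotProduct_smul, smul_dotProduct, smul_eq_mul, smul_eq_mul,
    ← mul_assoc, Real.sqrt_mul (by positivity), Real.sqrt_mul_self ht, weightedNorm]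

theorem weightedNorm_neg (A : Matrix (Fin d) (Fin d) ℝ) (v : Fin d → ℝ) :
    weightedNorm A (-v) = weightedNorm A v := by
  simp [weightedNorm, mulVec_neg]

/-- Along a strongly self-concordant function, the quadratic forms of the Hessians at two points
are comparable. -/
theorem StronglySelfConcordant.quad_hess_le (hM : StronglySelfConcordant M f)
    (x y z v : Fin d → ℝ) :
    v ⬝ᵥ (hess f y *ᵥ v) ≤
      (1 + M * weightedNorm (hess f z) (y - x)) * (v ⬝ᵥ (hess f x *ᵥ v)) := by
  have := (hM.hessian_close x y z x).quad_le v
  rw [quad_sub, quad_smul] at this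
  linarith

theorem lam_nonneg (f : (Fin d → ℝ) → ℝ) (x : Fin d → ℝ) : 0 ≤ lam f x := Real.sqrt_nonneg _

theorem lam_sq (hf : StronglyConvexSmooth μ L f) (x : Fin d → ℝ) :
    lam f x ^ 2 = grad f x ⬝ᵥ ((hess f x)⁻¹ *ᵥ grad f x) :=
  Real.sq_sqrt (quad_nonneg (hf.posDef_hess x).inv.posSemidef _)

theorem one_le_corr (hM : StronglySelfConcordant M f) (x : Fin d → ℝ)
    (G : Matrix (Fin d) (Fin d) ℝ) : 1 ≤ corr f M x G :=
  le_add_of_nonneg_right (mul_nonneg hM.constant_pos.le (weightedNorm_nonneg _ _))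

/-- The length of a quasi-Newton step is at most the Newton decrement. -/
theorem corr_le (hf : StronglyConvexSmooth μ L f) (hM : StronglySelfConcordant M f)
    {x : Fin d → ℝ} {G : Matrix (Fin d) (Fin d) ℝ} (h1 : LoewnerLE (hess f x) G) :
    corr f M x G ≤ 1 + M * lam f x := by
  have hA := hf.posDef_hess x
  have hG := h1.posDef hA
  refine add_le_add_right (mul_le_mul_of_nonneg_left ?_ hM.constant_pos.le) 1
  refine Real.sqrt_le_sqrt ?_
  have e : nextPoint f x G - x = -(G⁻¹ *ᵥ grad f x) := by rw [nextPoint]; abel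
  rw [e]
  simp only [mulVec_neg, neg_dotProduct, dotProduct_neg, neg_neg]
  refine (h1.quad_le _).trans ?_
  rw [mulVec_inv_mulVec hG, dotProduct_comm]
  have := quad_inv_le hA hG (c := 1) (fun x => by simpa using h1.quad_le x) (grad f x)
  simpa using this

/-- The decrease of the Newton decrement in a quasi-Newton step. -/
theorem lam_nextPoint_le (hf : StronglyConvexSmooth μ L f) (hM : StronglySelfConcordant M f)
    {x : Fin d → ℝ} {G : Matrix (Fin d) (Fin d) ℝ} {η ρ m : ℝ} (hη : 0 < η)
    (h1 : LoewnerLE (hess f x) G) (h2 : LoewnerLE G (η • hess f x))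
    (hm : corr f M x G = 1 + m) (hρ : 0 ≤ ρ) (hρ1 : ρ ≤ 1)
    (hρη : (1 - ρ) * (η * (1 + m)) ≤ 1) (hρm : m ≤ ρ) :
    lam f (nextPoint f x G) ≤ (1 + m / 2) * ρ * lam f x := by
  have hA := hf.posDef_hess x
  have hG := h1.posDef hA
  set p := nextPoint f x G with hp
  set h := p - x with hh
  have hxp : x + h = p := by rw [hh]; abel
  have hGh : G *ᵥ h = -grad f x := by
    have : h = -(G⁻¹ *ᵥ grad f x) := by rw [hh, hp, nextPoint]; abel
    rw [this, mulVec_neg, mulVec_inv_mulVec hG]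
  have hm' : m = M * weightedNorm (hess f x) h := by
    rw [corr] at hm
    exact (add_left_cancel hm).symm
  have hm0 : 0 ≤ m := by linarith [one_le_corr hM x G]
  have hAp := hf.posDef_hess p
  set y := (hess f p)⁻¹ *ᵥ grad f p with hy
  -- The direction `y` is fixed first, so the scalar mean value theorem suffices and the Hessian
  -- need not be integrated along the segment.
  obtain ⟨t, ⟨ht0, ht1⟩, ht⟩ := exists_hess_eq_grad_sub hf.twice_differentiable
    (fun x => (hf.posDef_hess x).1) x h y
  set H := hess f (x + t • h) with hHdef
  have hH : H.PosDef := hf.posDef_hess _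
  have htm : t * m ≤ m := by nlinarith
  have htm0 : 0 ≤ t * m := by positivity
  have hHA : ∀ v, v ⬝ᵥ (H *ᵥ v) ≤ (1 + t * m) * (v ⬝ᵥ (hess f x *ᵥ v)) := fun v => by
    have := hM.quad_hess_le x (x + t • h) x v
    rw [add_sub_cancel_left, weightedNorm_smul _ _ ht0.le] at this
    rwa [hm', mul_left_comm]
  have hAH : ∀ v, v ⬝ᵥ (hess f x *ᵥ v) ≤ (1 + t * m) * (v ⬝ᵥ (H *ᵥ v)) := fun v => by
    have := hM.quad_hess_le (x + t • h) x x v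
    rw [show x - (x + t • h) = -(t • h) by abel, weightedNorm_neg,
      weightedNorm_smul _ _ ht0.le] at this
    rwa [hm', mul_left_comm]
  have hHp : ∀ v, v ⬝ᵥ (H *ᵥ v) ≤ (1 + (1 - t) * m) * (v ⬝ᵥ (hess f p *ᵥ v)) := fun v => by
    have := hM.quad_hess_le p (x + t • h) x v
    rw [show x + t • h - p = -((1 - t) • h) by rw [← hxp]; module, weightedNorm_neg,
      weightedNorm_smul _ _ (by linarith)] at this
    rwa [hm', mul_left_comm]
  have hmain := sq_dotProduct_sub_le hH hG.1 hρ hρ1 (fun v => by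
    have e1 := h2.quad_le v
    rw [quad_smul] at e1
    have hv := quad_nonneg hH.posSemidef v
    calc (1 - ρ) * (v ⬝ᵥ (G *ᵥ v)) ≤ (1 - ρ) * (η * ((1 + m) * (v ⬝ᵥ (H *ᵥ v)))) := by
          refine mul_le_mul_of_nonneg_left (e1.trans ?_) (by linarith)
          refine mul_le_mul_of_nonneg_left ((hAH v).trans ?_) hη.le
          exact mul_le_mul_of_nonneg_right (by linarith) hv
      _ = (1 - ρ) * (η * (1 + m)) * (v ⬝ᵥ (H *ᵥ v)) := by ring
      _ ≤ v ⬝ᵥ (H *ᵥ v) := mul_le_of_le_one_left hv hρη) (fun v => by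
    have hv := quad_nonneg hA.posSemidef v
    calc v ⬝ᵥ (H *ᵥ v) ≤ (1 + t * m) * (v ⬝ᵥ (hess f x *ᵥ v)) := hHA v
      _ ≤ (1 + ρ) * (v ⬝ᵥ (hess f x *ᵥ v)) := mul_le_mul_of_nonneg_right (by linarith) hv
      _ ≤ (1 + ρ) * (v ⬝ᵥ (G *ᵥ v)) := mul_le_mul_of_nonneg_left (h1.quad_le v) (by linarith))
    y h
  have hyg : y ⬝ᵥ grad f p = lam f p ^ 2 := by rw [lam_sq hf, hy, dotProduct_comm]
  -- `yᵀHh = yᵀ(∇f(p) - ∇f(x))` and `Gh = -∇f(x)`, so the gradients at `x` cancel.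
  have hlhs : y ⬝ᵥ ((H - G) *ᵥ h) = lam f p ^ 2 := by
    rw [quad_sub, ← ht, hGh, hxp, dotProduct_neg, ← hyg]
    ring
  have hyp : y ⬝ᵥ (hess f p *ᵥ y) = lam f p ^ 2 := by
    rw [hy, mulVec_inv_mulVec hAp, ← hy, hyg]
  have hgH : (G *ᵥ h) ⬝ᵥ (H⁻¹ *ᵥ (G *ᵥ h)) ≤ (1 + t * m) * lam f x ^ 2 := by
    rw [hGh, mulVec_neg, neg_dotProduct_neg, lam_sq hf]
    exact quad_inv_le hA hH hAH _
  rw [hlhs] at hmain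
  have hfin : (lam f p ^ 2) ^ 2 ≤ lam f p ^ 2 * ((1 + m / 2) * ρ * lam f x) ^ 2 := by
    refine hmain.trans ?_
    have e1 : y ⬝ᵥ (H *ᵥ y) ≤ (1 + (1 - t) * m) * lam f p ^ 2 := hyp ▸ hHp y
    -- Passing from `H` to the two endpoints costs `(1 - t)m` and `tm`; AM–GM removes the unknown
    -- `t`.
    have e2 : (1 + (1 - t) * m) * (1 + t * m) ≤ (1 + m / 2) ^ 2 := by
      nlinarith [sq_nonneg ((1 - 2 * t) * m)]
    have e3 : 0 ≤ 1 + (1 - t) * m := by nlinarith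
    calc _ ≤ ((1 + (1 - t) * m) * lam f p ^ 2) * (ρ ^ 2 * ((1 + t * m) * lam f x ^ 2)) :=
          mul_le_mul e1 (mul_le_mul_of_nonneg_left hgH (sq_nonneg ρ))
            (mul_nonneg (sq_nonneg ρ) (quad_nonneg hH.inv.posSemidef _))
            (mul_nonneg e3 (sq_nonneg _))
      _ = ((1 + (1 - t) * m) * (1 + t * m)) * (lam f p ^ 2 * (ρ * lam f x) ^ 2) := by ring
      _ ≤ (1 + m / 2) ^ 2 * (lam f p ^ 2 * (ρ * lam f x) ^ 2) :=
          mul_le_mul_of_nonneg_right e2 (by positivity)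
      _ = _ := by ring
  have hx0 := lam_nonneg f x
  have hp0 := lam_nonneg f p
  have hR : 0 ≤ (1 + m / 2) * ρ * lam f x := by positivity
  rcases hp0.eq_or_lt with h0 | h0
  · rw [← h0]; exact hR
  · have : lam f p ^ 2 ≤ ((1 + m / 2) * ρ * lam f x) ^ 2 := by
      rw [pow_two (lam f p ^ 2)] at hfin
      exact le_of_mul_le_mul_left hfin (by positivity)
    exact (pow_le_pow_iff_left₀ hp0 hR two_ne_zero).1 this

theorem sigma_nonneg {A G : Matrix (Fin d) (Fin d) ℝ} (hA : A.PosDef) (h : LoewnerLE A G) :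
    0 ≤ sigma A G := trace_mul_nonneg h hA.inv.posSemidef

theorem loewnerLE_one_add_sigma {A G : Matrix (Fin d) (Fin d) ℝ} (hA : A.PosDef)
    (h : LoewnerLE A G) : LoewnerLE G ((1 + sigma A G) • A) := by
  refine loewnerLE_of_quad_le (h.posDef hA).1 (isHermitian_smul hA.1 _) fun x => ?_
  have := quad_le_trace_mul_inv hA h x
  rw [quad_sub] at this
  rw [quad_smul, sigma]
  linarith

/-- The decrease of the Newton decrement in terms of `σ`. -/
theorem lam_nextPoint_le_sigma (hf : StronglyConvexSmooth μ L f)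
    (hM : StronglySelfConcordant M f) {x : Fin d → ℝ} {G : Matrix (Fin d) (Fin d) ℝ}
    (h1 : LoewnerLE (hess f x) G) (hl : M * lam f x ≤ 1) :
    lam f (nextPoint f x G) ≤ (sigma (hess f x) G + 2 * (M * lam f x)) * lam f x := by
  have hA := hf.posDef_hess x
  set σ := sigma (hess f x) G
  have hσ : 0 ≤ σ := sigma_nonneg hA h1
  obtain ⟨m, hm⟩ : ∃ m, corr f M x G = 1 + m := ⟨corr f M x G - 1, by ring⟩
  have hm0 : 0 ≤ m := by linarith [one_le_corr hM x G]
  have hml : m ≤ M * lam f x := by linarith [corr_le hf hM h1]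
  have hx0 := lam_nonneg f x
  have hpos : 0 < (1 + σ) * (1 + m) := by positivity
  have hinv : 1 / ((1 + σ) * (1 + m)) ≤ 1 := by
    rw [div_le_one hpos]; nlinarith
  -- This `ρ` is the least value allowed by the two constraints `(1 - ρ)(1 + σ)(1 + m) ≤ 1` and `m ≤
  -- ρ`.
  refine (lam_nextPoint_le hf hM (η := 1 + σ) (ρ := max (1 - 1 / ((1 + σ) * (1 + m))) m)
    (by positivity) h1 (loewnerLE_one_add_sigma hA h1) hm (le_max_of_le_right hm0) (max_le ?_ ?_)
    ?_ (le_max_right _ _)).trans (mul_le_mul_of_nonneg_right ?_ hx0)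
  · linarith [div_pos one_pos hpos]
  · linarith
  · calc _ ≤ (1 / ((1 + σ) * (1 + m))) * ((1 + σ) * (1 + m)) :=
          mul_le_mul_of_nonneg_right (by linarith [le_max_left (1 - 1 / ((1 + σ) * (1 + m))) m])
            hpos.le
      _ = 1 := by field_simp
  · rw [mul_max_of_nonneg _ _ (by positivity)]
    refine max_le ?_ ?_
    · have e : 1 - 1 / ((1 + σ) * (1 + m)) = (σ + m + σ * m) / ((1 + σ) * (1 + m)) := by
        field_simp
        ring
      have : (1 + m / 2) * ((σ + m + σ * m) / ((1 + σ) * (1 + m))) ≤ σ + 2 * m := by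
        rw [← mul_div_assoc, div_le_iff₀ hpos]
        have a1 : 0 ≤ σ * m := by positivity
        have a2 : 0 ≤ σ * (σ * m) := by positivity
        have a3 : 0 ≤ m * (σ * m) := by positivity
        nlinarith [sq_nonneg σ, sq_nonneg m]
      rw [e]; linarith
    · nlinarith

end Decrement

/-! ### The effect of the correction and of the new Hessian on the potentials. -/

section Correction

variable {d : ℕ} {f : (Fin d → ℝ) → ℝ} {M μ L : ℝ} {x : Fin d → ℝ} {G : Matrix (Fin d) (Fin d) ℝ}

theorem quad_hess_nextPoint_le (hM : StronglySelfConcordant M f) (v : Fin d → ℝ) :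
    v ⬝ᵥ (hess f (nextPoint f x G) *ᵥ v) ≤ corr f M x G * (v ⬝ᵥ (hess f x *ᵥ v)) :=
  hM.quad_hess_le x _ x v

theorem quad_hess_le_nextPoint (hM : StronglySelfConcordant M f) (v : Fin d → ℝ) :
    v ⬝ᵥ (hess f x *ᵥ v) ≤ corr f M x G * (v ⬝ᵥ (hess f (nextPoint f x G) *ᵥ v)) := by
  have := hM.quad_hess_le (nextPoint f x G) x x v
  rwa [← weightedNorm_neg, neg_sub] at this

/-- The corrected matrix dominates the next Hessian. -/
theorem hess_nextPoint_loewnerLE (hf : StronglyConvexSmooth μ L f)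
    (hM : StronglySelfConcordant M f) (h1 : LoewnerLE (hess f x) G) :
    LoewnerLE (hess f (nextPoint f x G)) (corr f M x G • G) := by
  have hc := one_le_corr hM x G
  refine loewnerLE_of_quad_le (hf.posDef_hess _).1
    (isHermitian_smul (h1.posDef (hf.posDef_hess x)).1 _) fun v => ?_
  rw [quad_smul]
  exact (quad_hess_nextPoint_le hM v).trans
    (mul_le_mul_of_nonneg_left (h1.quad_le v) (by linarith))

theorem corr_smul_loewnerLE (hf : StronglyConvexSmooth μ L f)
    (hM : StronglySelfConcordant M f) {η : ℝ} (hη : 0 ≤ η) (h1 : LoewnerLE (hess f x) G)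
    (h2 : LoewnerLE G (η • hess f x)) :
    LoewnerLE (corr f M x G • G) ((corr f M x G ^ 2 * η) • hess f (nextPoint f x G)) := by
  have hc : 0 ≤ corr f M x G := by linarith [one_le_corr hM x G]
  refine loewnerLE_of_quad_le (isHermitian_smul (h1.posDef (hf.posDef_hess x)).1 _)
    (isHermitian_smul (hf.posDef_hess _).1 _) fun v => ?_
  have e := h2.quad_le v
  rw [quad_smul] at e
  rw [quad_smul, quad_smul]
  calc _ ≤ corr f M x G * (η * (corr f M x G * (v ⬝ᵥ (hess f (nextPoint f x G) *ᵥ v)))) :=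
        mul_le_mul_of_nonneg_left
          (e.trans (mul_le_mul_of_nonneg_left (quad_hess_le_nextPoint hM v) hη)) hc
    _ = _ := by ring

theorem one_le_smoothness_div (hd : 0 < d) (hf : StronglyConvexSmooth μ L f) : 1 ≤ L / μ := by
  rw [one_le_div hf.convexity_pos]
  have h1 := (hf.lower 0).quad_le (Pi.single ⟨0, hd⟩ 1)
  have h2 := (hf.upper 0).quad_le (Pi.single ⟨0, hd⟩ 1)
  have := h1.trans h2
  simpa [quad_smul] using this

theorem trace_hess_le (hf : StronglyConvexSmooth μ L f) (x : Fin d → ℝ) :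
    (hess f x).trace ≤ d * L := by
  have := trace_le_of_quad_le (hf.upper x).quad_le
  simpa [mul_comm] using this

/-- `∇²f ⪰ μI` gives `(∇²f)⁻¹ ⪯ μ⁻¹I`. SR1 contracts the plain trace, so its potential is `tr(G -
∇²f)/μ`; this is the source of the condition number in its constants. -/
theorem sigma_le_trace_div (hf : StronglyConvexSmooth μ L f) (h1 : LoewnerLE (hess f x) G) :
    sigma (hess f x) G ≤ (G - hess f x).trace / μ := by
  have hμ := hf.convexity_pos
  have hA := hf.posDef_hess x
  have key := trace_mul_le h1 hA.inv.1 (B := μ⁻¹ • 1)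
    (isHermitian_smul (PosDef.one (n := Fin d) (R := ℝ)).1 _) fun v => by
    have := quad_inv_le (PosDef.one (n := Fin d) (R := ℝ)) hA (c := μ⁻¹) (fun v => by
      have := (hf.lower x).quad_le v
      rw [quad_smul] at this
      rwa [le_inv_mul_iff₀ hμ]) v
    simpa [quad_smul] using this
  rw [sigma]
  refine key.trans (le_of_eq ?_)
  simp [div_eq_inv_mul]

/-- The growth of `σ` caused by the change of the Hessian and the correction. -/
theorem sigma_corr_le (hf : StronglyConvexSmooth μ L f) (hM : StronglySelfConcordant M f)
    (h1 : LoewnerLE (hess f x) G) :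
    sigma (hess f (nextPoint f x G)) (corr f M x G • G) ≤
      (1 + M * lam f x) ^ 2 * (sigma (hess f x) G + 2 * d * (M * lam f x)) := by
  have hA := hf.posDef_hess x
  have hA' := hf.posDef_hess (nextPoint f x G)
  have hG := h1.posDef hA
  have hc1 := one_le_corr hM x G
  have hc2 := corr_le hf hM h1
  set c := corr f M x G
  have hσ : 0 ≤ sigma (hess f x) G := sigma_nonneg hA h1
  have key := trace_mul_le hG.posSemidef hA'.inv.1 (B := c • (hess f x)⁻¹)
    (isHermitian_smul hA.inv.1 _) fun v => by
    rw [quad_smul]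
    exact quad_inv_le hA hA' (quad_hess_le_nextPoint hM) v
  rw [Algebra.mul_smul_comm, trace_smul, smul_eq_mul] at key
  rw [sigma_eq hA', smul_mul_assoc, trace_smul, smul_eq_mul]
  have e : (G * (hess f x)⁻¹).trace = sigma (hess f x) G + d := by rw [sigma_eq hA]; ring
  rw [e] at key
  have hd : (0 : ℝ) ≤ d := Nat.cast_nonneg d
  have hl := lam_nonneg f x
  have hM0 := hM.constant_pos.le
  set l := M * lam f x with hl'
  have hl0 : 0 ≤ l := by positivity
  calc _ ≤ c * (c * (sigma (hess f x) G + d)) - d := by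
        have := mul_le_mul_of_nonneg_left key (show 0 ≤ c by linarith)
        linarith
    _ = c ^ 2 * (sigma (hess f x) G + d) - d := by ring
    _ ≤ (1 + l) ^ 2 * (sigma (hess f x) G + d) - d := by
        have : c ^ 2 ≤ (1 + l) ^ 2 := pow_le_pow_left₀ (by linarith) hc2 2
        have := mul_le_mul_of_nonneg_right this (add_nonneg hσ hd)
        linarith
    _ ≤ _ := by
        -- Exactly the gap between `(1 + l)²·2dl` and `((1 + l)² - 1)d`.
        have : 0 ≤ d * (3 * l ^ 2 + 2 * l ^ 3) := by positivity
        nlinarith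

/-- The growth of `tr (G - ∇²f) / μ` caused by the change of the Hessian and the correction. -/
theorem trace_corr_le (hf : StronglyConvexSmooth μ L f) (hM : StronglySelfConcordant M f)
    (h1 : LoewnerLE (hess f x) G) :
    (corr f M x G • G - hess f (nextPoint f x G)).trace / μ ≤
      (1 + M * lam f x) ^ 2 * ((G - hess f x).trace / μ + 2 * d * (L / μ) * (M * lam f x)) := by
  have hμ := hf.convexity_pos
  have hL := hf.smoothness_pos
  have hA := hf.posDef_hess x
  have hc1 := one_le_corr hM x G
  have hc2 := corr_le hf hM h1
  have hT : (hess f x).trace ≤ corr f M x G * (hess f (nextPoint f x G)).trace := by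
    have := trace_le_of_quad_le (A := hess f x)
      (B := corr f M x G • hess f (nextPoint f x G)) fun v => by
        rw [quad_smul]; exact quad_hess_le_nextPoint hM v
    rwa [trace_smul, smul_eq_mul] at this
  have hT1 := trace_hess_le hf (nextPoint f x G)
  have hτ : 0 ≤ (G - hess f x).trace := h1.trace_nonneg
  have hT2 : 0 ≤ (hess f (nextPoint f x G)).trace := (hf.posDef_hess _).posSemidef.trace_nonneg
  rw [trace_sub] at hτ
  rw [trace_sub, trace_smul, smul_eq_mul, trace_sub]
  have hl := lam_nonneg f x
  have hM0 := hM.constant_pos.le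
  have hd : (0 : ℝ) ≤ d := Nat.cast_nonneg d
  set c := corr f M x G
  set l := M * lam f x with hl'
  have hl0 : 0 ≤ l := by positivity
  set T := (hess f x).trace
  set T' := (hess f (nextPoint f x G)).trace
  have e : (1 + l) ^ 2 * ((G.trace - T) / μ + 2 * d * (L / μ) * l) =
      ((1 + l) ^ 2 * ((G.trace - T) + 2 * d * L * l)) / μ := by
    field_simp
  rw [e]
  refine div_le_div_of_nonneg_right ?_ hμ.le
  -- Uses `T ≤ cT'`, the trace form of the comparison of consecutive Hessians.
  have e1 : c * G.trace - T' ≤ c * (G.trace - T) + (c ^ 2 - 1) * T' := by nlinarith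
  have hc2' : c ^ 2 ≤ (1 + l) ^ 2 := pow_le_pow_left₀ (by linarith) hc2 2
  have e2 : (c ^ 2 - 1) * T' ≤ ((1 + l) ^ 2 - 1) * (d * L) :=
    mul_le_mul (by linarith) hT1 hT2 (by nlinarith)
  have e3 : c * (G.trace - T) ≤ (1 + l) ^ 2 * (G.trace - T) :=
    mul_le_mul_of_nonneg_right (by nlinarith) hτ
  have e4 : 0 ≤ d * L * (3 * l ^ 2 + 2 * l ^ 3) := by positivity
  nlinarith

end Correction

/-! ### The scalar recursion and the role of the initial condition. -/

section ScalarRates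

/-- The ratio of the linear rate that holds for every update preserving `∇²f ⪯ G ⪯ η ∇²f`. -/
noncomputable def linearRatio (η : ℝ) : ℝ := 1 - 1 / (2 * η)

theorem linearRatio_mem {η : ℝ} (hη : 1 ≤ η) : 1 / 2 ≤ linearRatio η ∧ linearRatio η ≤ 1 := by
  have h1 : 1 / (2 * η) ≤ 1 / 2 := one_div_le_one_div_of_le (by norm_num) (by linarith)
  have h2 : 0 ≤ 1 / (2 * η) := by positivity
  constructor <;> rw [linearRatio] <;> linarith

theorem sum_linearRatio_le {η : ℝ} (hη : 1 ≤ η) (k : ℕ) :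
    ∑ j ∈ Finset.range k, linearRatio η ^ j ≤ 2 * η := by
  have h := geom_sum_mul_neg (linearRatio η) k
  have h1 : 1 - linearRatio η = (2 * η)⁻¹ := by rw [linearRatio]; ring
  have h2 : 0 ≤ linearRatio η ^ k := pow_nonneg (by linarith [linearRatio_mem hη]) k
  rw [h1, ← div_eq_mul_inv, div_eq_iff (by positivity)] at h
  rw [h]
  nlinarith

/-- The factor by which the potential contracts in step `k`, when the Newton decrement is
at most `a` times the linear rate. -/
noncomputable def contraction (ρ c η a : ℝ) (k : ℕ) : ℝ :=
  ρ * (1 + a * linearRatio η ^ k) ^ 2 + c * (a * linearRatio η ^ k)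

/-- The contraction factors multiply up to at most `2 ρ ^ k`. -/
theorem le_of_contraction {ρ c η a : ℝ} (hρ : 1 / 2 ≤ ρ) (hc : 0 ≤ c) (hη : 1 ≤ η) (ha : 0 ≤ a)
    (hlog : 4 * η * (c + 1) * a ≤ Real.log 2) {e : ℕ → ℝ} (he : ∀ k, 0 ≤ e k)
    (h : ∀ k, e (k + 1) ≤ contraction ρ c η a k * e k) (k : ℕ) : e k ≤ 2 * ρ ^ k * e 0 := by
  have hq : 0 ≤ linearRatio η := by linarith [linearRatio_mem hη]
  have key : ∀ k, e k ≤
      ρ ^ k * Real.exp ((2 + 2 * c) * (a * ∑ j ∈ Finset.range k, linearRatio η ^ j)) * e 0 := by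
    intro k
    induction k with
    | zero => simp
    | succ k ih =>
      set S := ∑ j ∈ Finset.range k, linearRatio η ^ j
      set t := a * linearRatio η ^ k with ht
      have ht0 : 0 ≤ t := by positivity
      have hc' : contraction ρ c η a k ≤ ρ * Real.exp ((2 + 2 * c) * t) := by
        rw [contraction, ← ht]
        have h1 : 1 + t ≤ Real.exp t := by linarith [Real.add_one_le_exp t]
        have h2 : 1 + 2 * c * t ≤ Real.exp (2 * c * t) := by
          linarith [Real.add_one_le_exp (2 * c * t)]
        have h3 : (1 + t) ^ 2 ≤ Real.exp t ^ 2 := pow_le_pow_left₀ (by positivity) h1 2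
        have h4 : Real.exp ((2 + 2 * c) * t) = Real.exp t ^ 2 * Real.exp (2 * c * t) := by
          rw [← Real.exp_nat_mul, ← Real.exp_add]
          congr 1
          push_cast
          ring
        have h6 : 0 ≤ c * t := by positivity
        -- `1/2 ≤ ρ` gives `ct ≤ ρ·2ct`, so `ρ` factors out and the rest is exponential in `t`.
        calc _ ≤ ρ * ((1 + t) ^ 2 * (1 + 2 * c * t)) := by
              have : 0 ≤ ρ * (c * t) * (2 * t + t ^ 2) := by positivity
              nlinarith
          _ ≤ _ := by
              rw [h4]
              exact mul_le_mul_of_nonneg_left (mul_le_mul h3 h2 (by positivity) (by positivity))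
                (by linarith)
      calc e (k + 1) ≤ contraction ρ c η a k * e k := h k
        _ ≤ (ρ * Real.exp ((2 + 2 * c) * t)) *
            (ρ ^ k * Real.exp ((2 + 2 * c) * (a * S)) * e 0) :=
          mul_le_mul hc' ih (he k) (by positivity)
        _ = _ := by
          rw [Finset.sum_range_succ, mul_add a, mul_add (2 + 2 * c), Real.exp_add, pow_succ]
          ring
  refine (key k).trans (mul_le_mul_of_nonneg_right ?_ (he 0))
  rw [mul_comm]
  refine mul_le_mul_of_nonneg_right ?_ (pow_nonneg (by linarith) k)
  -- The exponent is at most `(2 + 2c)·a·2η = 4η(c + 1)a`, which the initial condition bounds by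
  -- `log 2`.
  rw [← Real.le_log_iff_exp_le two_pos]
  refine le_trans ?_ hlog
  have := mul_le_mul_of_nonneg_left (sum_linearRatio_le hη k) ha
  nlinarith

end ScalarRates

/-! ### Rates for abstract runs with a potential. -/

section Rates

variable {d : ℕ} {f : (Fin d → ℝ) → ℝ} {M μ L η : ℝ} {x : ℕ → Fin d → ℝ}
  {G : ℕ → Matrix (Fin d) (Fin d) ℝ}

theorem LoewnerLE.trans {A B C : Matrix (Fin d) (Fin d) ℝ} (h1 : LoewnerLE A B)
    (h2 : LoewnerLE B C) : LoewnerLE A C := by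
  have := PosSemidef.add h2 h1
  rwa [sub_add_sub_cancel] at this

theorem loewnerLE_smul_smul {A : Matrix (Fin d) (Fin d) ℝ} (hA : A.PosDef) {a b : ℝ}
    (h : a ≤ b) : LoewnerLE (a • A) (b • A) := by
  rw [LoewnerLE, ← sub_smul]
  exact hA.posSemidef.smul (sub_nonneg.2 h)

/-- The iterates come from quasi-Newton steps, with updates of the corrected matrices that
preserve two-sided bounds relative to the next Hessian. -/
structure IsUpdateRun (f : (Fin d → ℝ) → ℝ) (M : ℝ) (x : ℕ → Fin d → ℝ)
    (G : ℕ → Matrix (Fin d) (Fin d) ℝ) : Prop where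
  point : ∀ k, x (k + 1) = nextPoint f (x k) (G k)
  matrix : ∀ k (c : ℝ), 1 ≤ c → LoewnerLE (hess f (x (k + 1))) (corr f M (x k) (G k) • G k) →
    LoewnerLE (corr f M (x k) (G k) • G k) (c • hess f (x (k + 1))) →
    LoewnerLE (hess f (x (k + 1))) (G (k + 1)) ∧ LoewnerLE (G (k + 1)) (c • hess f (x (k + 1)))

/-- The linear rate of the Newton decrement, and the bounds of the matrices. -/
theorem IsUpdateRun.linear_rate (h : IsUpdateRun f M x G) (hf : StronglyConvexSmooth μ L f)
    (hM : StronglySelfConcordant M f) (hη : 1 ≤ η) (h0 : LoewnerLE (hess f (x 0)) (G 0))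
    (h0η : LoewnerLE (G 0) (η • hess f (x 0)))
    (hlog : 20 * η * (M * lam f (x 0)) ≤ Real.log 2) (k : ℕ) :
    LoewnerLE (hess f (x k)) (G k) ∧ LoewnerLE (G k) ((2 * η) • hess f (x k)) ∧
      lam f (x k) ≤ linearRatio η ^ k * lam f (x 0) := by
  obtain ⟨hq1, hq2⟩ := linearRatio_mem hη
  have hq0 : 0 ≤ linearRatio η := by linarith
  have hM0 := hM.constant_pos
  have hl0 := lam_nonneg f (x 0)
  set a := M * lam f (x 0) with ha
  have ha0 : 0 ≤ a := by positivity
  have hln : Real.log 2 ≤ 0.7 := by linarith [Real.log_two_lt_d9]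
  have hηa : η * a ≤ 0.035 := by linarith
  have haη : a ≤ 0.035 := by nlinarith
  -- `η E k` is the invariant upper factor for `G k`: step `k` multiplies it by at most `(1 + a qᵏ)²
  -- ≤ exp(2a qᵏ)`. As `ηa ≤ 0.7/20 = 0.035`, the exponent stays below `0.14` and `E` below `1.2`.
  set E : ℕ → ℝ := fun k => Real.exp (2 * (a * ∑ j ∈ Finset.range k, linearRatio η ^ j)) with hE
  have hE1 : ∀ k, 1 ≤ E k := fun k => Real.one_le_exp (mul_nonneg two_pos.le
    (mul_nonneg ha0 (Finset.sum_nonneg fun j _ => pow_nonneg hq0 j)))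
  have hE2 : ∀ k, E k ≤ 1.2 := fun k => by
    have h1 : 2 * (a * ∑ j ∈ Finset.range k, linearRatio η ^ j) ≤ 0.14 := by
      have := mul_le_mul_of_nonneg_left (sum_linearRatio_le hη k) ha0
      linarith
    refine (Real.exp_le_exp.2 h1).trans ?_
    have h2 := Real.one_sub_le_exp_neg 0.14
    rw [Real.exp_neg] at h2
    have h3 := Real.exp_pos 0.14
    have h4 : (1 - 0.14) * Real.exp 0.14 ≤ 1 := by
      have := mul_le_mul_of_nonneg_right h2 h3.le
      rwa [inv_mul_cancel₀ h3.ne'] at this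
    norm_num at h4 ⊢
    linarith
  suffices H : LoewnerLE (hess f (x k)) (G k) ∧ LoewnerLE (G k) ((η * E k) • hess f (x k)) ∧
      lam f (x k) ≤ linearRatio η ^ k * lam f (x 0) by
    refine ⟨H.1, H.2.1.trans (loewnerLE_smul_smul (hf.posDef_hess _) ?_), H.2.2⟩
    nlinarith [hE2 k]
  induction k with
  | zero => simpa [hE] using ⟨h0, h0η⟩
  | succ k ih =>
    obtain ⟨i1, i2, i3⟩ := ih
    have hc1 := one_le_corr hM (x k) (G k)
    have hc2 := corr_le hf hM i1
    have hqk : linearRatio η ^ k ≤ 1 := pow_le_one₀ hq0 hq2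
    have hl : M * lam f (x k) ≤ a * linearRatio η ^ k := by
      have := mul_le_mul_of_nonneg_left i3 hM0.le
      rw [ha]
      linarith
    have hla : a * linearRatio η ^ k ≤ a := mul_le_of_le_one_right ha0 hqk
    obtain ⟨m, hm⟩ : ∃ m, corr f M (x k) (G k) = 1 + m := ⟨corr f M (x k) (G k) - 1, by ring⟩
    have hm0 : 0 ≤ m := by linarith
    have hma : m ≤ a := by linarith
    have hηm : η * m ≤ 0.035 := (mul_le_mul_of_nonneg_left hma (by linarith)).trans hηa
    have hEk := hE1 k
    have hEk2 := hE2 k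
    have hb := h.matrix k (corr f M (x k) (G k) ^ 2 * (η * E k))
      (one_le_mul_of_one_le_of_one_le (one_le_pow₀ hc1) (one_le_mul_of_one_le_of_one_le hη hEk))
      (by rw [h.point]; exact hess_nextPoint_loewnerLE hf hM i1)
      (by rw [h.point]; exact corr_smul_loewnerLE hf hM (by positivity) i1 i2)
    refine ⟨hb.1, hb.2.trans (loewnerLE_smul_smul (hf.posDef_hess _) ?_), ?_⟩
    · have e1 : corr f M (x k) (G k) ≤ Real.exp (a * linearRatio η ^ k) := by
        linarith [Real.add_one_le_exp (a * linearRatio η ^ k)]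
      have e2 : E (k + 1) = Real.exp (a * linearRatio η ^ k) ^ 2 * E k := by
        rw [hE]
        simp only [Finset.sum_range_succ]
        rw [← Real.exp_nat_mul, ← Real.exp_add]
        congr 1
        push_cast
        ring
      rw [e2, mul_left_comm]
      exact mul_le_mul_of_nonneg_left (mul_le_mul_of_nonneg_right
        (pow_le_pow_left₀ (by linarith) e1 2) (by linarith)) (by linarith)
    · have hpos : 0 < 1 + m / 2 := by positivity
      -- Dividing by `1 + m/2` cancels the factor in the conclusion, so the decrement shrinks by
      -- exactly the linear ratio.
      have key := lam_nextPoint_le hf hM (η := η * E k) (ρ := linearRatio η / (1 + m / 2))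
        (by positivity) i1 i2 hm (by positivity) (by rw [div_le_one hpos]; linarith) ?_ ?_
      · rw [h.point, pow_succ']
        refine key.trans (le_of_eq_of_le ?_ (mul_le_mul_of_nonneg_left i3 hq0) |>.trans_eq ?_)
        · field_simp
        · ring
      · have e : (1 - linearRatio η / (1 + m / 2)) * (η * E k * (1 + m)) =
            (η * m + 1) / 2 * E k * (1 + m) / (1 + m / 2) := by
          rw [linearRatio]
          field_simp
          ring
        rw [e, div_le_one hpos]
        have h5 : (η * m + 1) / 2 * E k ≤ 0.6 * 1.2 :=
          mul_le_mul (by linarith) hEk2 (by linarith) (by norm_num)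
        nlinarith
      · rw [le_div_iff₀ hpos]
        nlinarith

/-- `V` dominates `σ` along the run, and `W`, its value after the correction, is controlled. -/
structure IsPotential (f : (Fin d → ℝ) → ℝ) (M : ℝ) (x : ℕ → Fin d → ℝ)
    (G : ℕ → Matrix (Fin d) (Fin d) ℝ) (c : ℝ) (V W : ℕ → ℝ) : Prop where
  sigma_le : ∀ k, sigma (hess f (x k)) (G k) ≤ V k
  corr_le : ∀ k, W k ≤ (1 + M * lam f (x k)) ^ 2 * (V k + c * (M * lam f (x k)))

/-- The combination of a potential and the Newton decrement that contracts. -/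
noncomputable def theta (f : (Fin d → ℝ) → ℝ) (M : ℝ) (x : ℕ → Fin d → ℝ) (c : ℝ)
    (V : ℕ → ℝ) (k : ℕ) : ℝ :=
  V k + c * (M * lam f (x k))

variable {c : ℝ} {V W : ℕ → ℝ}

/-- With `c ≥ 4`, which follows from `d ≥ 2`, the superlinear threshold implies the weaker one
needed for the linear rate. -/
theorem four_mul_log_le {t η c a : ℝ} (hη : 1 ≤ η) (hc : 4 ≤ c) (ha : 0 ≤ a)
    (hlog : 4 * η * (c + 1) * a ≤ t) : 20 * η * a ≤ t := by
  refine le_trans ?_ hlog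
  have : 0 ≤ η * a * (c - 4) := by
    have : 0 ≤ c - 4 := by linarith
    positivity
  nlinarith

theorem mul_lam_le_one (hη : 1 ≤ η) (hM : StronglySelfConcordant M f)
    (hlog : 20 * η * (M * lam f (x 0)) ≤ Real.log 2)
    {k : ℕ} (hk : lam f (x k) ≤ linearRatio η ^ k * lam f (x 0)) :
    M * lam f (x k) ≤ M * lam f (x 0) * linearRatio η ^ k ∧
      M * lam f (x 0) * linearRatio η ^ k ≤ 1 ∧ M * lam f (x 0) ≤ 1 / 4 := by
  obtain ⟨hq1, hq2⟩ := linearRatio_mem hη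
  have hq0 : 0 ≤ linearRatio η := by linarith
  have ha : 0 ≤ M * lam f (x 0) := mul_nonneg hM.constant_pos.le (lam_nonneg _ _)
  have h1 := mul_le_mul_of_nonneg_left hk hM.constant_pos.le
  have h2 := mul_le_of_le_one_right ha (pow_le_one₀ hq0 hq2 (n := k))
  have h3 : Real.log 2 ≤ 0.7 := by linarith [Real.log_two_lt_d9]
  have h4 : M * lam f (x 0) ≤ 1 / 4 := by nlinarith
  exact ⟨by linarith, by linarith, h4⟩

theorem theta_nonneg (hf : StronglyConvexSmooth μ L f) (hM : StronglySelfConcordant M f)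
    (hp : IsPotential f M x G c V W) (hc : 0 ≤ c) (hG : ∀ k, LoewnerLE (hess f (x k)) (G k))
    (k : ℕ) : 0 ≤ V k ∧ 0 ≤ theta f M x c V k := by
  have h1 := (sigma_nonneg (hf.posDef_hess _) (hG k)).trans (hp.sigma_le k)
  exact ⟨h1, add_nonneg h1
    (mul_nonneg hc (mul_nonneg hM.constant_pos.le (lam_nonneg _ _)))⟩

theorem IsUpdateRun.lam_succ_le (h : IsUpdateRun f M x G) (hf : StronglyConvexSmooth μ L f)
    (hM : StronglySelfConcordant M f) (hp : IsPotential f M x G c V W) (hc : 4 ≤ c)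
    (hG : ∀ k, LoewnerLE (hess f (x k)) (G k)) {k : ℕ} (hl : M * lam f (x k) ≤ 1) :
    lam f (x (k + 1)) ≤ theta f M x c V k * lam f (x k) := by
  rw [h.point]
  refine (lam_nextPoint_le_sigma hf hM (hG k) hl).trans
    (mul_le_mul_of_nonneg_right ?_ (lam_nonneg _ _))
  have := mul_nonneg hM.constant_pos.le (lam_nonneg f (x k))
  rw [theta]
  nlinarith [hp.sigma_le k]

theorem corr_potential_le (hf : StronglyConvexSmooth μ L f) (hM : StronglySelfConcordant M f)
    (hp : IsPotential f M x G c V W) (hc : 0 ≤ c) (hG : ∀ k, LoewnerLE (hess f (x k)) (G k))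
    {k : ℕ} {b : ℝ} (hl : M * lam f (x k) ≤ b) :
    W k ≤ (1 + b) ^ 2 * theta f M x c V k := by
  refine (hp.corr_le k).trans
    (mul_le_mul_of_nonneg_right (pow_le_pow_left₀ ?_ (by linarith) 2)
      (theta_nonneg hf hM hp hc hG k).2)
  have := mul_nonneg hM.constant_pos.le (lam_nonneg f (x k))
  linarith

theorem hasRates_of_theta_le {C ρ : ℝ} (hG : ∀ k, LoewnerLE (hess f (x k)) (G k))
    (hC : 0 ≤ C) (hρ : 0 ≤ ρ) {θ : ℕ → ℝ} (hσ : ∀ k, sigma (hess f (x k)) (G k) ≤ θ k)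
    (hθ : ∀ k, θ k ≤ C * ρ ^ k) (hl : ∀ k, lam f (x (k + 1)) ≤ θ k * lam f (x k)) :
    HasRates f x G C ρ := by
  refine fun k => ⟨hG k, (hσ k).trans (hθ k), ?_⟩
  induction k with
  | zero => simp
  | succ k ih =>
    -- The exponents are triangular numbers in truncated natural arithmetic, valid also at `k = 0`.
    have e : (k + 1) * (k + 1 - 1) / 2 = k * (k - 1) / 2 + k := by
      rw [Nat.triangle_succ]
    calc lam f (x (k + 1)) ≤ (C * ρ ^ k) * (C ^ k * ρ ^ (k * (k - 1) / 2) * lam f (x 0)) :=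
          (hl k).trans (mul_le_mul (hθ k) ih (lam_nonneg _ _) (by positivity))
      _ = _ := by
          rw [e, pow_add, pow_succ]
          ring

/-- The rates of a deterministic method whose updates contract the potential by `ρ`. -/
theorem IsUpdateRun.hasRates (h : IsUpdateRun f M x G) (hf : StronglyConvexSmooth μ L f)
    (hM : StronglySelfConcordant M f) (hη : 1 ≤ η) (h0 : LoewnerLE (hess f (x 0)) (G 0))
    (h0η : LoewnerLE (G 0) (η • hess f (x 0))) (hc : 4 ≤ c)
    (hlog : 4 * η * (c + 1) * (M * lam f (x 0)) ≤ Real.log 2)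
    (hp : (∀ k, LoewnerLE (hess f (x k)) (G k)) → IsPotential f M x G c V W)
    {ρ : ℝ} (hρ : 1 / 2 ≤ ρ) (hV0 : V 0 ≤ c / 2 * (η - 1))
    (hV : (∀ k, LoewnerLE (hess f (x k)) (G k)) → ∀ k, V (k + 1) ≤ ρ * W k) :
    HasRates f x G (c * η) ρ := by
  have ha : 0 ≤ M * lam f (x 0) := mul_nonneg hM.constant_pos.le (lam_nonneg _ _)
  have hlog' := four_mul_log_le hη hc ha hlog
  have hlin := h.linear_rate hf hM hη h0 h0η hlog'
  have hG := fun k => (hlin k).1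
  have hp := hp hG
  have hV := hV hG
  have hl := fun k => mul_lam_le_one hη hM hlog' (hlin k).2.2
  have hθ := fun k => (theta_nonneg hf hM hp (by linarith) hG k).2
  have hlam := fun k => h.lam_succ_le hf hM hp hc hG ((hl k).1.trans (hl k).2.1)
  -- The factor contains the a priori bound `a qᵏ` instead of `Mλ_k`; this decouples the recursion
  -- for `theta`.
  have hstep : ∀ k, theta f M x c V (k + 1) ≤
      contraction ρ c η (M * lam f (x 0)) k * theta f M x c V k := fun k => by
    have e1 := corr_potential_le hf hM hp (by linarith) hG (hl k).1
    have e2 := mul_le_mul_of_nonneg_left e1 (show 0 ≤ ρ by linarith)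
    have e3 : M * lam f (x (k + 1)) ≤
        M * lam f (x 0) * linearRatio η ^ k * theta f M x c V k := by
      have := mul_le_mul_of_nonneg_left (hlam k) hM.constant_pos.le
      have := mul_le_mul_of_nonneg_right (hl k).1 (hθ k)
      linarith
    have e4 := mul_le_mul_of_nonneg_left e3 (show 0 ≤ c by linarith)
    have e5 := hV k
    rw [contraction, theta]
    linarith
  have hfin := le_of_contraction hρ (by linarith) hη ha hlog hθ hstep
  refine hasRates_of_theta_le hG (mul_nonneg (by linarith) (by linarith)) (by linarith)
    (θ := theta f M x c V) (fun k => ?_) (fun k => (hfin k).trans ?_) hlam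
  · have := mul_nonneg (show 0 ≤ c by linarith)
      (mul_nonneg hM.constant_pos.le (lam_nonneg f (x k)))
    rw [theta]
    linarith [hp.sigma_le k]
  -- `c(η - 1)/2 + ca ≤ cη/2`, since `a ≤ 1/4`; the factor `2` from the contraction then gives the
  -- constant `cη`.
  · have e : theta f M x c V 0 ≤ c * η / 2 := by
      rw [theta]
      nlinarith [(hl 0).2.2]
    have := mul_le_mul_of_nonneg_left e (show 0 ≤ 2 * ρ ^ k by positivity)
    linarith

end Rates

/-! ### The concrete runs and the greedy methods. -/

section Runs

variable {d : ℕ} {f : (Fin d → ℝ) → ℝ} {M μ L η : ℝ} {x₀ : Fin d → ℝ}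
  {G₀ K₀ : Matrix (Fin d) (Fin d) ℝ}

theorem isUpdateRun_bfgs (hf : StronglyConvexSmooth μ L f) (w : ℕ → Fin d → ℝ) :
    IsUpdateRun f M (fun k => (bfgsRun f M x₀ G₀ K₀ w k).x)
      (fun k => (bfgsRun f M x₀ G₀ K₀ w k).G) where
  point _ := rfl
  matrix _ _ hc h1 h2 := BFGS_bounds (hf.posDef_hess _) hc h1 h2 _

theorem isUpdateRun_sr1 (hf : StronglyConvexSmooth μ L f) (u : ℕ → Fin d → ℝ) :
    IsUpdateRun f M (fun k => (sr1Run f M x₀ G₀ u k).x) (fun k => (sr1Run f M x₀ G₀ u k).G) where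
  point _ := rfl
  matrix _ _ _ h1 h2 := SR1_bounds (hf.posDef_hess _) h1 h2 _

theorem corrK_transpose_mul (hM : StronglySelfConcordant M f) {s : BFGSState d}
    (hG : s.G.PosDef) (hK : s.Kᵀ * s.K = s.G⁻¹) :
    (s.corrK f M)ᵀ * s.corrK f M = (s.corrG f M)⁻¹ := by
  have hc : 0 < corr f M s.x s.G := by linarith [one_le_corr hM s.x s.G]
  rw [BFGSState.corrK, BFGSState.corrG, transpose_smul, smul_mul_assoc, Algebra.mul_smul_comm,
    smul_smul, hK, ← mul_inv, Real.mul_self_sqrt hc.le]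
  refine (inv_eq_right_inv ?_).symm
  rw [smul_mul_smul_comm, mul_inv_cancel₀ hc.ne', mul_inv_of_posDef hG, one_smul]

theorem posDef_corrG (hM : StronglySelfConcordant M f) {s : BFGSState d} (hG : s.G.PosDef) :
    (s.corrG f M).PosDef :=
  hG.smul (by linarith [one_le_corr hM s.x s.G])

theorem bfgsRun_factor (hf : StronglyConvexSmooth μ L f) (hM : StronglySelfConcordant M f)
    (hK₀ : K₀ᵀ * K₀ = G₀⁻¹) {w : ℕ → Fin d → ℝ}
    (hG : ∀ k, (bfgsRun f M x₀ G₀ K₀ w k).G.PosDef) (k : ℕ) :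
    (bfgsRun f M x₀ G₀ K₀ w k).Kᵀ * (bfgsRun f M x₀ G₀ K₀ w k).K =
      (bfgsRun f M x₀ G₀ K₀ w k).G⁻¹ := by
  induction k with
  | zero => exact hK₀
  | succ k ih =>
    exact factorUpdate_transpose_mul (posDef_corrG hM (hG k)) (hf.posDef_hess _)
      (corrK_transpose_mul hM (hG k) ih) (w k)

theorem isPotential_sigma (hf : StronglyConvexSmooth μ L f) (hM : StronglySelfConcordant M f)
    {x : ℕ → Fin d → ℝ} {G : ℕ → Matrix (Fin d) (Fin d) ℝ}
    (hx : ∀ k, x (k + 1) = nextPoint f (x k) (G k))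
    (hG : ∀ k, LoewnerLE (hess f (x k)) (G k)) :
    IsPotential f M x G (2 * d) (fun k => sigma (hess f (x k)) (G k))
      (fun k => sigma (hess f (x (k + 1))) (corr f M (x k) (G k) • G k)) where
  sigma_le _ := le_rfl
  corr_le k := by
    rw [hx]
    exact sigma_corr_le hf hM (hG k)

theorem isPotential_trace (hf : StronglyConvexSmooth μ L f) (hM : StronglySelfConcordant M f)
    {x : ℕ → Fin d → ℝ} {G : ℕ → Matrix (Fin d) (Fin d) ℝ}
    (hx : ∀ k, x (k + 1) = nextPoint f (x k) (G k))
    (hG : ∀ k, LoewnerLE (hess f (x k)) (G k)) :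
    IsPotential f M x G (2 * d * (L / μ)) (fun k => (G k - hess f (x k)).trace / μ)
      (fun k => (corr f M (x k) (G k) • G k - hess f (x (k + 1))).trace / μ) where
  sigma_le k := sigma_le_trace_div hf (hG k)
  corr_le k := by
    rw [hx]
    exact trace_corr_le hf hM (hG k)

theorem sigma_init_le {A G : Matrix (Fin d) (Fin d) ℝ} (hA : A.PosDef) (h1 : LoewnerLE A G)
    (h2 : LoewnerLE G (η • A)) : sigma A G ≤ 2 * d / 2 * (η - 1) := by
  have := trace_mul_le hA.inv.posSemidef (h1.posDef hA).1 (isHermitian_smul hA.1 η) h2.quad_le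
  rw [Algebra.mul_smul_comm, inv_mul_of_posDef hA, trace_smul, trace_one, Fintype.card_fin,
    trace_mul_comm, smul_eq_mul] at this
  rw [sigma_eq hA]
  linarith

theorem trace_init_le (hf : StronglyConvexSmooth μ L f) (hη : 1 ≤ η) {x : Fin d → ℝ}
    {G : Matrix (Fin d) (Fin d) ℝ} (h2 : LoewnerLE G (η • hess f x)) :
    (G - hess f x).trace / μ ≤ 2 * d * (L / μ) / 2 * (η - 1) := by
  have hμ := hf.convexity_pos
  have := trace_le_of_quad_le h2.quad_le
  rw [trace_smul, smul_eq_mul] at this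
  have h3 := mul_le_mul_of_nonneg_left (trace_hess_le hf x) (sub_nonneg.2 hη)
  rw [div_le_iff₀ hμ, trace_sub]
  have e : 2 * d * (L / μ) / 2 * (η - 1) * μ = (η - 1) * (d * L) := by
    field_simp
  rw [e]
  linarith

theorem half_le_ratio (hd : 2 ≤ d) : (1 : ℝ) / 2 ≤ 1 - 1 / d := by
  have h : (2 : ℝ) ≤ d := by exact_mod_cast hd
  have := one_div_le_one_div_of_le two_pos h
  linarith

theorem four_le_two_mul (hd : 2 ≤ d) : (4 : ℝ) ≤ 2 * d := by
  have h : (2 : ℝ) ≤ d := by exact_mod_cast hd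
  linarith

theorem four_le_two_mul_mul (hd : 2 ≤ d) (hf : StronglyConvexSmooth μ L f) :
    (4 : ℝ) ≤ 2 * d * (L / μ) := by
  have h1 := one_le_smoothness_div (by omega) hf
  have h2 := four_le_two_mul hd
  nlinarith

theorem mul_le_log_of_le_div {a c : ℝ} (hη : 1 ≤ η) (hc : 0 ≤ c)
    (h : a ≤ Real.log 2 / (4 * η * (c + 1))) : 4 * η * (c + 1) * a ≤ Real.log 2 := by
  rwa [le_div_iff₀ (by positivity), mul_comm] at h

/-- The decrease of `σ` in a step of the BFGS method. -/
theorem sigma_bfgsRun_succ_le (hf : StronglyConvexSmooth μ L f) (hM : StronglySelfConcordant M f)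
    (hK₀ : K₀ᵀ * K₀ = G₀⁻¹) {w : ℕ → Fin d → ℝ}
    (hG : ∀ k, (bfgsRun f M x₀ G₀ K₀ w k).G.PosDef) (k : ℕ) :
    let s := bfgsRun f M x₀ G₀ K₀ w k
    let A := hess f (bfgsRun f M x₀ G₀ K₀ w (k + 1)).x
    let B := ((s.corrK f M)⁻¹)ᵀ * A⁻¹ * (s.corrK f M)⁻¹
    B.PosSemidef ∧ B.trace = sigma A (s.corrG f M) + d ∧
      sigma A (bfgsRun f M x₀ G₀ K₀ w (k + 1)).G ≤
        sigma A (s.corrG f M) + 1 - (w k ⬝ᵥ w k)⁻¹ * (w k ⬝ᵥ (B *ᵥ w k)) := by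
  intro s A B
  have hK := corrK_transpose_mul hM (hG k) (bfgsRun_factor hf hM hK₀ hG k)
  have hA : A.PosDef := hf.posDef_hess _
  exact ⟨posSemidef_scaled hA _, trace_scaled (posDef_corrG hM (hG k)) hA hK,
    sigma_BFGS_le (posDef_corrG hM (hG k)) hA hK (w k)⟩

theorem greedy_bfgs_hasRates (hd : 2 ≤ d) (hf : StronglyConvexSmooth μ L f)
    (hM : StronglySelfConcordant M f) (hη : 1 ≤ η) (hG₀ : LoewnerLE (hess f x₀) G₀)
    (hG₀η : LoewnerLE G₀ (η • hess f x₀))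
    (hlog : M * lam f x₀ ≤ Real.log 2 / (4 * η * (2 * d + 1))) (hK₀ : K₀ᵀ * K₀ = G₀⁻¹)
    {w : ℕ → Fin d → ℝ} (hw : IsGreedyBFGS f M x₀ G₀ K₀ w) :
    HasRates f (fun k => (bfgsRun f M x₀ G₀ K₀ w k).x)
      (fun k => (bfgsRun f M x₀ G₀ K₀ w k).G) (2 * d * η) (1 - 1 / d) := by
  have hrun := isUpdateRun_bfgs (M := M) (x₀ := x₀) (G₀ := G₀) (K₀ := K₀) hf w
  have hd0 : (0 : ℝ) < d := by exact_mod_cast (by omega : 0 < d)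
  refine hrun.hasRates hf hM hη hG₀ hG₀η (four_le_two_mul hd)
    (mul_le_log_of_le_div hη (by positivity) hlog)
    (fun hG => isPotential_sigma hf hM hrun.point hG) (half_le_ratio hd)
    (sigma_init_le (hf.posDef_hess x₀) hG₀ hG₀η) fun hG k => ?_
  obtain ⟨-, h2, h3⟩ := sigma_bfgsRun_succ_le hf hM hK₀ (w := w)
    (fun k => (hG k).posDef (hf.posDef_hess _)) k
  obtain ⟨h4, h5⟩ := (hw k).trace_le
  rw [h2] at h5
  rw [h4, inv_one, one_mul] at h3
  refine h3.trans ?_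
  -- The scaled matrix has trace `σ + d`, so its share `(σ + d)/d` cancels the `+ 1` of the BFGS
  -- update and leaves `(1 - 1/d)σ`.
  rw [← div_le_iff₀' hd0, add_div, div_self hd0.ne'] at h5
  change _ ≤ (1 - 1 / (d : ℝ)) * sigma _ ((bfgsRun f M x₀ G₀ K₀ w k).corrG f M)
  rw [sub_mul, one_mul, one_div_mul_eq_div]
  linarith

/-- The decrease of `tr (G - ∇²f) / μ` in a step of the SR1 method. -/
theorem trace_sr1Run_succ_le (hf : StronglyConvexSmooth μ L f) (hM : StronglySelfConcordant M f)
    {u : ℕ → Fin d → ℝ}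
    (hG : ∀ k, LoewnerLE (hess f (sr1Run f M x₀ G₀ u k).x) (sr1Run f M x₀ G₀ u k).G) (k : ℕ) :
    let s := sr1Run f M x₀ G₀ u k
    let A := hess f (sr1Run f M x₀ G₀ u (k + 1)).x
    let B := μ⁻¹ • (s.corrG f M - A)
    B.PosSemidef ∧ B.trace = (s.corrG f M - A).trace / μ ∧
      ((sr1Run f M x₀ G₀ u (k + 1)).G - A).trace / μ ≤
        (s.corrG f M - A).trace / μ - (u k ⬝ᵥ u k)⁻¹ * (u k ⬝ᵥ (B *ᵥ u k)) := by
  intro s A B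
  have hμ := hf.convexity_pos
  have h1 : LoewnerLE A (s.corrG f M) := hess_nextPoint_loewnerLE hf hM (hG k)
  refine ⟨PosSemidef.smul h1 (inv_nonneg.2 hμ.le), ?_, ?_⟩
  · simp only [B, trace_smul, smul_eq_mul, div_eq_inv_mul]
  · have := div_le_div_of_nonneg_right (trace_SR1_sub_le h1 (u k)) hμ.le
    refine this.trans (le_of_eq ?_)
    simp only [B, quad_smul]
    ring

theorem greedy_sr1_hasRates (hd : 2 ≤ d) (hf : StronglyConvexSmooth μ L f)
    (hM : StronglySelfConcordant M f) (hη : 1 ≤ η) (hG₀ : LoewnerLE (hess f x₀) G₀)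
    (hG₀η : LoewnerLE G₀ (η • hess f x₀))
    (hlog : M * lam f x₀ ≤ Real.log 2 / (4 * η * (2 * d * (L / μ) + 1)))
    {u : ℕ → Fin d → ℝ} (hu : IsGreedySR1 f M x₀ G₀ u) :
    HasRates f (fun k => (sr1Run f M x₀ G₀ u k).x)
      (fun k => (sr1Run f M x₀ G₀ u k).G) (2 * d * (L / μ) * η) (1 - 1 / d) := by
  have hrun := isUpdateRun_sr1 (M := M) (x₀ := x₀) (G₀ := G₀) hf u
  have hd0 : (0 : ℝ) < d := by exact_mod_cast (by omega : 0 < d)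
  have hc := four_le_two_mul_mul hd hf
  have hμ := hf.convexity_pos
  refine hrun.hasRates hf hM hη hG₀ hG₀η hc
    (mul_le_log_of_le_div hη (by linarith) hlog)
    (fun hG => isPotential_trace hf hM hrun.point hG) (half_le_ratio hd)
    (trace_init_le hf hη hG₀η) fun hG k => ?_
  obtain ⟨-, -, h3⟩ := trace_sr1Run_succ_le hf hM hG k
  obtain ⟨h4, h5⟩ := (hu k).trace_le
  rw [h4, inv_one, one_mul, quad_smul] at h3
  refine h3.trans ?_
  change _ ≤ (1 - 1 / (d : ℝ)) * (((sr1Run f M x₀ G₀ u k).corrG f M - _).trace / μ)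
  rw [← div_le_iff₀' hd0] at h5
  have h6 := mul_le_mul_of_nonneg_left h5 (inv_nonneg.2 hμ.le)
  refine (sub_le_sub_left h6 _).trans (le_of_eq ?_)
  ring

end Runs

/-! ### Measurable dependence of the iterates on the directions. -/

section Measurability

variable {d : ℕ} {Ω : Type*} [MeasurableSpace Ω]

/-- A random matrix with measurable entries. -/
def EntryMeasurable (A : Ω → Matrix (Fin d) (Fin d) ℝ) : Prop :=
  ∀ i j, Measurable fun ω => A ω i j

variable {A B : Ω → Matrix (Fin d) (Fin d) ℝ} {u v : Ω → Fin d → ℝ} {c : Ω → ℝ}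

theorem measurable_dotProduct (hu : Measurable u) (hv : Measurable v) :
    Measurable fun ω => u ω ⬝ᵥ v ω :=
  Finset.measurable_fun_sum _ fun i _ =>
    ((measurable_pi_apply i).comp hu).mul ((measurable_pi_apply i).comp hv)

namespace EntryMeasurable

theorem const (A : Matrix (Fin d) (Fin d) ℝ) : EntryMeasurable fun _ : Ω => A :=
  fun _ _ => measurable_const

theorem add (hA : EntryMeasurable A) (hB : EntryMeasurable B) :
    EntryMeasurable fun ω => A ω + B ω :=
  fun i j => (hA i j).add (hB i j)

theorem sub (hA : EntryMeasurable A) (hB : EntryMeasurable B) :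
    EntryMeasurable fun ω => A ω - B ω :=
  fun i j => (hA i j).sub (hB i j)

theorem smul (hc : Measurable c) (hA : EntryMeasurable A) : EntryMeasurable fun ω => c ω • A ω :=
  fun i j => hc.mul (hA i j)

theorem transpose (hA : EntryMeasurable A) : EntryMeasurable fun ω => (A ω)ᵀ :=
  fun i j => hA j i

theorem mul (hA : EntryMeasurable A) (hB : EntryMeasurable B) :
    EntryMeasurable fun ω => A ω * B ω := fun i j => by
  simp only [mul_apply]
  exact Finset.measurable_fun_sum _ fun k _ => (hA i k).mul (hB k j)

theorem mulVec (hA : EntryMeasurable A) (hu : Measurable u) :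
    Measurable fun ω => A ω *ᵥ u ω :=
  measurable_pi_lambda _ fun i =>
    measurable_dotProduct (measurable_pi_lambda _ fun j => hA i j) hu

theorem vecMul (hA : EntryMeasurable A) (hu : Measurable u) :
    Measurable fun ω => u ω ᵥ* A ω := by
  simp only [← mulVec_transpose]
  exact hA.transpose.mulVec hu

theorem vecMulVec (hu : Measurable u) (hv : Measurable v) :
    EntryMeasurable fun ω => Matrix.vecMulVec (u ω) (v ω) :=
  fun i j => ((measurable_pi_apply i).comp hu).mul ((measurable_pi_apply j).comp hv)

theorem det (hA : EntryMeasurable A) : Measurable fun ω => (A ω).det := by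
  simp only [det_apply]
  exact Finset.measurable_fun_sum _ fun σ _ =>
    (Finset.measurable_fun_prod _ fun i _ => hA _ _).const_smul _

/-- By Cramer's rule each entry is a quotient of determinants; no invertibility is required, as
division by zero is also measurable. -/
theorem inv (hA : EntryMeasurable A) : EntryMeasurable fun ω => (A ω)⁻¹ := fun i j => by
  simp only [inv_def, Ring.inverse_eq_inv', Matrix.smul_apply, adjugate_apply, smul_eq_mul]
  refine hA.det.inv.mul (det fun k l => ?_)
  by_cases h : k = j
  · simp only [updateRow_apply, if_pos h]
    exact measurable_const
  · simp only [updateRow_apply, if_neg h]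
    exact hA k l

theorem trace (hA : EntryMeasurable A) : Measurable fun ω => (A ω).trace :=
  Finset.measurable_fun_sum _ fun i _ => hA i i

end EntryMeasurable

theorem measurable_grad (f : (Fin d → ℝ) → ℝ) : Measurable (grad f) :=
  measurable_pi_lambda _ fun _ => measurable_fderiv_apply_const ℝ f _

theorem measurable_hess_apply (f : (Fin d → ℝ) → ℝ) (i j : Fin d) :
    Measurable fun x => hess f x i j :=
  (measurable_fderiv_apply_const ℝ (fderiv ℝ f) (Pi.single i 1)).apply_continuousLinearMap _

variable (f : (Fin d → ℝ) → ℝ) (M : ℝ) {x : Ω → Fin d → ℝ} {G K : Ω → Matrix (Fin d) (Fin d) ℝ}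

theorem entryMeasurable_hess (hx : Measurable x) : EntryMeasurable fun ω => hess f (x ω) :=
  fun i j => (measurable_hess_apply f i j).comp hx

theorem measurable_lam (hx : Measurable x) : Measurable fun ω => lam f (x ω) := by
  have hg := (measurable_grad f).comp hx
  exact (measurable_dotProduct hg ((entryMeasurable_hess f hx).inv.mulVec hg)).sqrt

theorem measurable_sigma (hA : EntryMeasurable A) (hG : EntryMeasurable G) :
    Measurable fun ω => sigma (A ω) (G ω) :=
  ((hG.sub hA).mul hA.inv).trace

theorem measurable_weightedNorm (hA : EntryMeasurable A) (hu : Measurable u) :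
    Measurable fun ω => weightedNorm (A ω) (u ω) :=
  (measurable_dotProduct hu (hA.mulVec hu)).sqrt

theorem measurable_nextPoint (hx : Measurable x) (hG : EntryMeasurable G) :
    Measurable fun ω => nextPoint f (x ω) (G ω) :=
  hx.sub (hG.inv.mulVec ((measurable_grad f).comp hx))

theorem measurable_corr (hx : Measurable x) (hG : EntryMeasurable G) :
    Measurable fun ω => corr f M (x ω) (G ω) :=
  ((measurable_weightedNorm (entryMeasurable_hess f hx)
    ((measurable_nextPoint f hx hG).sub hx)).const_mul M).const_add 1

theorem entryMeasurable_SR1 (hG : EntryMeasurable G) (hA : EntryMeasurable A) (hu : Measurable u) :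
    EntryMeasurable fun ω => SR1 (G ω) (A ω) (u ω) := by
  simp only [SR1_eq]
  have hD := hG.sub hA
  have hDu := hD.mulVec hu
  exact hG.sub (.smul (measurable_dotProduct hu hDu).inv (.vecMulVec hDu (hD.vecMul hu)))

theorem entryMeasurable_BFGS (hG : EntryMeasurable G) (hA : EntryMeasurable A)
    (hu : Measurable u) : EntryMeasurable fun ω => BFGS (G ω) (A ω) (u ω) :=
  (hG.sub (.smul (measurable_dotProduct hu (hG.mulVec hu)).inv
    (.vecMulVec (hG.mulVec hu) (hG.vecMul hu)))).add
    (.smul (measurable_dotProduct hu (hA.mulVec hu)).inv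
    (.vecMulVec (hA.mulVec hu) (hA.vecMul hu)))

theorem entryMeasurable_factorUpdate (hK : EntryMeasurable K) (hA : EntryMeasurable A)
    (hu : Measurable u) : EntryMeasurable fun ω => factorUpdate (K ω) (A ω) (u ω) := by
  have hv := hK.transpose.mulVec hu
  have hAv := hA.mulVec hv
  exact hK.sub (.smul (measurable_dotProduct hv hAv).inv (.vecMulVec ((hK.mulVec hAv).sub
    (((measurable_weightedNorm hA hv).div (measurable_dotProduct hu hu).sqrt).smul hu)) hv))

/-- The state of the SR1 method depends measurably on the directions used so far. -/
theorem measurable_sr1Run (x₀ : Fin d → ℝ) (G₀ : Matrix (Fin d) (Fin d) ℝ)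
    {u : ℕ → Ω → Fin d → ℝ} (k : ℕ) (hu : ∀ j < k, Measurable (u j)) :
    (Measurable fun ω => (sr1Run f M x₀ G₀ (fun n => u n ω) k).x) ∧
      EntryMeasurable fun ω => (sr1Run f M x₀ G₀ (fun n => u n ω) k).G := by
  induction k with
  | zero => exact ⟨measurable_const, .const _⟩
  | succ k ih =>
    obtain ⟨hx, hG⟩ := ih fun j hj => hu j (by omega)
    have hn := measurable_nextPoint f hx hG
    exact ⟨hn, entryMeasurable_SR1 (.smul (measurable_corr f M hx hG) hG)
      (entryMeasurable_hess f hn) (hu k (by omega))⟩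

/-- The state of the BFGS method depends measurably on the directions used so far. -/
theorem measurable_bfgsRun (x₀ : Fin d → ℝ) (G₀ K₀ : Matrix (Fin d) (Fin d) ℝ)
    {w : ℕ → Ω → Fin d → ℝ} (k : ℕ) (hw : ∀ j < k, Measurable (w j)) :
    (Measurable fun ω => (bfgsRun f M x₀ G₀ K₀ (fun n => w n ω) k).x) ∧
      (EntryMeasurable fun ω => (bfgsRun f M x₀ G₀ K₀ (fun n => w n ω) k).G) ∧
      EntryMeasurable fun ω => (bfgsRun f M x₀ G₀ K₀ (fun n => w n ω) k).K := by
  induction k with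
  | zero => exact ⟨measurable_const, .const _, .const _⟩
  | succ k ih =>
    obtain ⟨hx, hG, hK⟩ := ih fun j hj => hw j (by omega)
    have hn := measurable_nextPoint f hx hG
    have hc := measurable_corr f M hx hG
    have hK' : EntryMeasurable fun ω =>
        (bfgsRun f M x₀ G₀ K₀ (fun n => w n ω) k).corrK f M := .smul hc.sqrt.inv hK
    exact ⟨hn, entryMeasurable_BFGS (.smul hc hG) (entryMeasurable_hess f hn)
      (hK'.transpose.mulVec (hw k (by omega))),
      entryMeasurable_factorUpdate hK' (entryMeasurable_hess f hn) (hw k (by omega))⟩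

end Measurability

/-! ### Spherically symmetric laws have isotropic directions. -/

section Isotropy

variable {d : ℕ} {ν : Measure (Fin d → ℝ)}

theorem measurable_direction (i j : Fin d) :
    Measurable fun u : Fin d → ℝ => u i * u j / (u ⬝ᵥ u) :=
  ((measurable_pi_apply i).mul (measurable_pi_apply j)).div
    (measurable_dotProduct measurable_id measurable_id)

theorem abs_direction_le (u : Fin d → ℝ) (i j : Fin d) : |u i * u j / (u ⬝ᵥ u)| ≤ 1 := by
  have hle : ∀ i, u i * u i ≤ u ⬝ᵥ u := fun i =>
    Finset.single_le_sum (f := fun i => u i * u i) (fun i _ => mul_self_nonneg _)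
      (Finset.mem_univ i)
  have h0 : 0 ≤ u ⬝ᵥ u := (mul_self_nonneg _).trans (hle i)
  rw [abs_div, abs_of_nonneg h0]
  refine div_le_one_of_le₀ ?_ h0
  rw [abs_le]
  constructor <;> nlinarith [hle i, hle j, sq_nonneg (u i - u j), sq_nonneg (u i + u j)]

theorem integrable_direction [IsProbabilityMeasure ν] (i j : Fin d) :
    Integrable (fun u : Fin d → ℝ => u i * u j / (u ⬝ᵥ u)) ν :=
  .of_bound (measurable_direction i j).aestronglyMeasurable 1
    (.of_forall fun u => abs_direction_le u i j)

theorem IsSphericallySymmetric.integral_direction_comp (h : IsSphericallySymmetric ν)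
    {Q : Matrix (Fin d) (Fin d) ℝ} (hQ : Q ∈ orthogonalGroup (Fin d) ℝ) (i j : Fin d) :
    ∫ u, u i * u j / (u ⬝ᵥ u) ∂ν = ∫ u, (Q *ᵥ u) i * (Q *ᵥ u) j / (u ⬝ᵥ u) ∂ν := by
  have hm : Measurable fun u : Fin d → ℝ => Q *ᵥ u :=
    (EntryMeasurable.const Q).mulVec measurable_id
  conv_lhs => rw [← h.2.2 Q hQ]
  rw [integral_map hm.aemeasurable (measurable_direction i j).aestronglyMeasurable]
  have e : ∀ u : Fin d → ℝ, (Q *ᵥ u) ⬝ᵥ (Q *ᵥ u) = u ⬝ᵥ u := fun u => by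
    have hQ' : Qᵀ * Q = 1 := (mem_orthogonalGroup_iff' _ _).1 hQ
    rw [dotProduct_mulVec, ← mulVec_transpose, mulVec_mulVec, hQ', one_mulVec]
  simp only [e]

/-- A spherically symmetric law that does not charge the origin has isotropic directions. -/
theorem IsSphericallySymmetric.isIsotropicDirection (hd : 0 < d) (h : IsSphericallySymmetric ν) :
    IsIsotropicDirection ν := by
  have hν := h.1
  have hd' : (0 : ℝ) < d := by exact_mod_cast hd
  refine ⟨hν, ?_⟩
  have hoff : ∀ i j : Fin d, i ≠ j → ∫ u, u i * u j / (u ⬝ᵥ u) ∂ν = 0 := fun i j hij => by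
    -- Reflecting one coordinate reverses the sign of the off-diagonal moment.
    set D : Matrix (Fin d) (Fin d) ℝ := diagonal fun k => if k = i then -1 else 1
    have hD : D ∈ orthogonalGroup (Fin d) ℝ := by
      rw [mem_orthogonalGroup_iff]
      simp only [D, diagonal_transpose, diagonal_mul_diagonal]
      rw [← diagonal_one]
      congr 1
      ext k
      by_cases hk : k = i <;> simp [hk]
    have h1 := h.integral_direction_comp hD i j
    simp only [D, mulVec_diagonal, if_true, if_neg hij.symm, one_mul, neg_mul, neg_div,
      integral_neg] at h1
    linarith
  have hdiag : ∀ i j : Fin d, ∫ u, u i * u i / (u ⬝ᵥ u) ∂ν = ∫ u, u j * u j / (u ⬝ᵥ u) ∂ν :=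
    fun i j => by
    -- Swapping two coordinates identifies the diagonal moments, which sum to `1` because the origin
    -- is not charged.
    set Q : Matrix (Fin d) (Fin d) ℝ := (Equiv.swap i j).permMatrix ℝ
    have hQ : Q ∈ orthogonalGroup (Fin d) ℝ := by
      rw [mem_orthogonalGroup_iff]
      simp only [Q, transpose_permMatrix, ← permMatrix_mul]
      simp
    have h1 := h.integral_direction_comp hQ i i
    simpa [Q, permMatrix_mulVec] using h1
  have hsum : ∑ i : Fin d, ∫ u, u i * u i / (u ⬝ᵥ u) ∂ν = 1 := by
    rw [← integral_finsetSum _ fun i _ => integrable_direction i i]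
    have : (fun u : Fin d → ℝ => ∑ i, u i * u i / (u ⬝ᵥ u)) =ᵐ[ν] fun _ => 1 := by
      have h0 : ∀ᵐ u ∂ν, u ≠ 0 := by
        rw [ae_iff]; simpa using h.2.1
      filter_upwards [h0] with u hu
      rw [← Finset.sum_div]
      exact div_self (dotProduct_self_eq_zero.not.2 hu)
    rw [integral_congr_ae this]
    simp
  ext i j
  by_cases hij : i = j
  · subst hij
    have : ∑ k : Fin d, ∫ u, u k * u k / (u ⬝ᵥ u) ∂ν =
        d * ∫ u, u i * u i / (u ⬝ᵥ u) ∂ν := by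
      rw [Finset.sum_congr rfl fun k _ => hdiag k i]
      simp
    rw [hsum] at this
    simp only [of_apply, Matrix.smul_apply, one_apply_eq, smul_eq_mul, mul_one]
    rw [eq_div_iff hd'.ne', mul_comm]
    exact this.symm
  · simp [hoff i j hij, one_apply_ne hij]

end Isotropy

/-! ### Expected contraction and the passage to high probability. -/

section Expectation

variable {d : ℕ} {Ω : Type*}

/-- The σ-algebra generated by the first `k` directions. -/
abbrev past (w : ℕ → Ω → Fin d → ℝ) (k : ℕ) : MeasurableSpace Ω :=
  ⨆ j ∈ Set.Iio k, MeasurableSpace.comap (w j) inferInstance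

theorem measurable_past (w : ℕ → Ω → Fin d → ℝ) {j k : ℕ} (h : j < k) :
    Measurable[past w k] (w j) :=
  (comap_measurable (w j)).mono
    (le_iSup₂ (f := fun j (_ : j ∈ Set.Iio k) => MeasurableSpace.comap (w j) inferInstance) j h)
    le_rfl

variable [mΩ : MeasurableSpace Ω] {P : Measure Ω} {ν : Measure (Fin d → ℝ)}
  {w : ℕ → Ω → Fin d → ℝ}

/-- Disjoint blocks of an independent family are independent; the direction of step `k` is thus
independent of every quantity fixed before it is drawn. -/
theorem IsIIDWithLaw.indepFun_past (h : IsIIDWithLaw P w ν) {k : ℕ} {X : Ω → ℝ}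
    (hX : Measurable[past w k] X) : IndepFun X (w k) P := by
  rw [IndepFun_iff_Indep]
  have h1 := indep_iSup_of_disjoint (fun j => (h.1 j).comap_le) ((iIndepFun_iff_iIndep ..).1 h.2.2)
    (S := Set.Iio k) (T := {k}) (by simp)
  rw [iSup_singleton] at h1
  exact indep_of_indep_of_le_left h1 hX.comap_le

/-- The Rayleigh quotient is linear in `B`, with bounded coefficients that depend on `u` alone.
Integrability and independence can therefore be used entry by entry, without conditional
expectations. -/
theorem quad_direction_eq (B : Matrix (Fin d) (Fin d) ℝ) (u : Fin d → ℝ) :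
    (u ⬝ᵥ u)⁻¹ * (u ⬝ᵥ (B *ᵥ u)) = ∑ i, ∑ j, B i j * (u i * u j / (u ⬝ᵥ u)) := by
  generalize u ⬝ᵥ u = s
  simp only [dotProduct, mulVec, Finset.mul_sum]
  exact Finset.sum_congr rfl fun i _ => Finset.sum_congr rfl fun j _ => by
    rw [div_eq_inv_mul]
    ring

/-- The mean of a quadratic form along an independent isotropic direction. -/
theorem integral_quad_direction (hν : IsIsotropicDirection ν) {v : Ω → Fin d → ℝ}
    (hv : Measurable v) (hlaw : P.map v = ν) {B : Ω → Matrix (Fin d) (Fin d) ℝ}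
    (hB : ∀ i j, Integrable (fun ω => B ω i j) P)
    (hind : ∀ i j, IndepFun (fun ω => B ω i j) v P) :
    Integrable (fun ω => (v ω ⬝ᵥ v ω)⁻¹ * (v ω ⬝ᵥ (B ω *ᵥ v ω))) P ∧
      ∫ ω, (v ω ⬝ᵥ v ω)⁻¹ * (v ω ⬝ᵥ (B ω *ᵥ v ω)) ∂P = (∫ ω, (B ω).trace ∂P) / d := by
  have hm : ∀ i j, AEStronglyMeasurable (fun ω => v ω i * v ω j / (v ω ⬝ᵥ v ω)) P :=
    fun i j => ((measurable_direction i j).comp hv).aestronglyMeasurable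
  have hint : ∀ i j, Integrable (fun ω => B ω i j * (v ω i * v ω j / (v ω ⬝ᵥ v ω))) P :=
    fun i j => (hB i j).mul_bdd (hm i j) (.of_forall fun ω => abs_direction_le (v ω) i j)
  have hval : ∀ i j, ∫ ω, B ω i j * (v ω i * v ω j / (v ω ⬝ᵥ v ω)) ∂P =
      (∫ ω, B ω i j ∂P) * ((1 / (d : ℝ)) • (1 : Matrix (Fin d) (Fin d) ℝ)) i j := fun i j => by
    have h1 : IndepFun (fun ω => B ω i j) (fun ω => v ω i * v ω j / (v ω ⬝ᵥ v ω)) P :=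
      (hind i j).comp measurable_id (measurable_direction i j)
    rw [h1.integral_fun_mul_eq_mul_integral (hB i j).1 (hm i j), ← hν.2, of_apply, ← hlaw,
      integral_map hv.aemeasurable (measurable_direction i j).aestronglyMeasurable]
  simp only [quad_direction_eq]
  refine ⟨integrable_finsetSum _ fun i _ => integrable_finsetSum _ fun j _ => hint i j, ?_⟩
  rw [integral_finsetSum _ fun i _ => integrable_finsetSum _ fun j _ => hint i j]
  simp only [Matrix.trace, diag_apply]
  rw [integral_finsetSum _ fun i _ => hB i i, Finset.sum_div]
  refine Finset.sum_congr rfl fun i _ => ?_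
  rw [integral_finsetSum _ fun j _ => hint i j, Finset.sum_eq_single i]
  · rw [hval, Matrix.smul_apply, one_apply_eq, smul_eq_mul, mul_one, mul_one_div]
  · intro j _ hj
    rw [hval, Matrix.smul_apply, one_apply_ne hj.symm, smul_zero, mul_zero]
  · simp

variable [IsProbabilityMeasure P]

/-- The expected contraction of the potential of a random method. -/
theorem expected_contraction (hd : 0 < d) (hν : IsIsotropicDirection ν) (hw : IsIIDWithLaw P w ν)
    {V W l : ℕ → Ω → ℝ} {B : ℕ → Ω → Matrix (Fin d) (Fin d) ℝ} {c β η a t : ℝ}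
    (hη : 1 ≤ η) (ha : 0 ≤ a) (hc : 0 ≤ c)
    (mV : ∀ k, Measurable (V k)) (mW : ∀ k, Measurable (W k)) (ml : ∀ k, Measurable (l k))
    (mB : ∀ k i j, Measurable[past w k] fun ω => B k ω i j)
    (V0 : ∀ k ω, 0 ≤ V k ω) (l0 : ∀ k ω, 0 ≤ l k ω) (ht : ∀ ω, V 0 ω + c * l 0 ω ≤ t)
    (hW : ∀ k ω, W k ω ≤ (1 + a * linearRatio η ^ k) ^ 2 * (V k ω + c * l k ω))
    (hl : ∀ k ω, l (k + 1) ω ≤ a * linearRatio η ^ k * (V k ω + c * l k ω))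
    (hB : ∀ k ω, (B k ω).PosSemidef) (hBt : ∀ k ω, (B k ω).trace = W k ω + d * β)
    (hV : ∀ k ω, V (k + 1) ω ≤
      W k ω + β - (w k ω ⬝ᵥ w k ω)⁻¹ * (w k ω ⬝ᵥ (B k ω *ᵥ w k ω))) (k : ℕ) :
    Integrable (fun ω => V k ω + c * l k ω) P ∧
      ∫ ω, V (k + 1) ω + c * l (k + 1) ω ∂P ≤
        contraction (1 - 1 / d) c η a k * ∫ ω, V k ω + c * l k ω ∂P := by
  have hd0 : (0 : ℝ) < d := by exact_mod_cast hd
  have hd1 : (0 : ℝ) ≤ 1 - 1 / d := by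
    rw [sub_nonneg, div_le_one hd0]; exact_mod_cast hd
  have hq : 0 ≤ linearRatio η := by linarith [linearRatio_mem hη]
  have hb : ∀ k, 0 ≤ a * linearRatio η ^ k := fun k => by positivity
  have hθ : ∀ k ω, 0 ≤ V k ω + c * l k ω := fun k ω =>
    add_nonneg (V0 k ω) (mul_nonneg hc (l0 k ω))
  have hWlow : ∀ k ω, 0 ≤ W k ω + d * β := fun k ω => hBt k ω ▸ (hB k ω).trace_nonneg
  have hpast : ∀ k, past w k ≤ mΩ := fun k => iSup₂_le fun j _ => (hw.1 j).comap_le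
  have step : ∀ k, Integrable (fun ω => V k ω + c * l k ω) P →
      Integrable (W k) P ∧ Integrable (V (k + 1)) P ∧ Integrable (l (k + 1)) P := fun k hk => by
    have iW : Integrable (W k) P := by
      refine ((hk.const_mul ((1 + a * linearRatio η ^ k) ^ 2)).add
        (integrable_const (|(d : ℝ) * β|))).mono' (mW k).aestronglyMeasurable
        (.of_forall fun ω => ?_)
      have h2 : 0 ≤ (1 + a * linearRatio η ^ k) ^ 2 * (V k ω + c * l k ω) :=
        mul_nonneg (sq_nonneg _) (hθ k ω)
      rw [Real.norm_eq_abs, abs_le, Pi.add_apply]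
      constructor
      · linarith [hWlow k ω, le_abs_self ((d : ℝ) * β)]
      · linarith [hW k ω, abs_nonneg ((d : ℝ) * β)]
    refine ⟨iW, ?_, ?_⟩
    · refine (iW.add (integrable_const β)).mono' (mV _).aestronglyMeasurable
        (.of_forall fun ω => ?_)
      rw [Real.norm_eq_abs, abs_of_nonneg (V0 _ _), Pi.add_apply]
      have : 0 ≤ (w k ω ⬝ᵥ w k ω)⁻¹ * (w k ω ⬝ᵥ (B k ω *ᵥ w k ω)) := by
        refine mul_nonneg (inv_nonneg.2 ?_) (quad_nonneg (hB k ω) _)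
        exact Finset.sum_nonneg fun i _ => mul_self_nonneg _
      linarith [hV k ω]
    · refine (hk.const_mul (a * linearRatio η ^ k)).mono' (ml _).aestronglyMeasurable
        (.of_forall fun ω => ?_)
      rw [Real.norm_eq_abs, abs_of_nonneg (l0 _ _)]
      exact hl k ω
  have hint : ∀ k, Integrable (fun ω => V k ω + c * l k ω) P := fun k => by
    induction k with
    | zero =>
      refine .of_bound ((mV 0).add ((ml 0).const_mul c)).aestronglyMeasurable t
        (.of_forall fun ω => ?_)
      rw [Real.norm_eq_abs, abs_of_nonneg (hθ 0 ω)]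
      exact ht ω
    | succ k ih =>
      obtain ⟨-, h1, h2⟩ := step k ih
      exact h1.add (h2.const_mul c)
  refine ⟨hint k, ?_⟩
  obtain ⟨iW, iV, il⟩ := step k (hint k)
  have iB : ∀ i j, Integrable (fun ω => B k ω i j) P := fun i j => by
    refine (iW.add (integrable_const ((d : ℝ) * β))).mono'
      ((mB k i j).mono (hpast k) le_rfl).aestronglyMeasurable (.of_forall fun ω => ?_)
    rw [Pi.add_apply, ← hBt]
    exact abs_apply_le_trace (hB k ω) i j
  obtain ⟨iq, eq⟩ := integral_quad_direction hν (hw.1 k) (hw.2.1 k) iB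
    fun i j => hw.indepFun_past (mB k i j)
  -- The mean Rayleigh quotient is `(E W + dβ)/d`, so `β` cancels. It is `1` for BFGS and `0` for
  -- SR1.
  have e1 : ∫ ω, V (k + 1) ω ∂P ≤ (1 - 1 / d) * ∫ ω, W k ω ∂P := by
    refine (integral_mono iV ((iW.add (integrable_const β)).sub iq) (hV k)).trans (le_of_eq ?_)
    rw [integral_sub' (iW.add (integrable_const β)) iq, eq, integral_add' iW (integrable_const β)]
    simp only [hBt]
    rw [integral_add iW (integrable_const _)]
    simp only [integral_const, probReal_univ, one_smul]
    field_simp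
    ring
  have e2 : ∫ ω, W k ω ∂P ≤
      (1 + a * linearRatio η ^ k) ^ 2 * ∫ ω, V k ω + c * l k ω ∂P := by
    rw [← integral_const_mul]
    exact integral_mono iW ((hint k).const_mul _) (hW k)
  have e3 : ∫ ω, l (k + 1) ω ∂P ≤ a * linearRatio η ^ k * ∫ ω, V k ω + c * l k ω ∂P := by
    rw [← integral_const_mul]
    exact integral_mono il ((hint k).const_mul _) (hl k)
  rw [integral_add iV (il.const_mul c), integral_const_mul, contraction]
  have e4 := mul_le_mul_of_nonneg_left e2 hd1
  have e5 := mul_le_mul_of_nonneg_left e3 hc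
  linarith

/-- Geometric decay of the means gives a slightly slower geometric decay with high probability. -/
theorem measure_geometric_tail_le (hd : 0 < d) {θ : ℕ → Ω → ℝ} (hθ : ∀ k ω, 0 ≤ θ k ω)
    (hi : ∀ k, Integrable (θ k) P) {C δ : ℝ} (hC : 0 < C) (hδ : 0 < δ)
    (h : ∀ k, ∫ ω, θ k ω ∂P ≤ C * (1 - 1 / (d : ℝ)) ^ k) :
    P.real {ω | ∃ k, d ^ 2 * C / δ * (1 - 1 / ((d : ℝ) + 1)) ^ k ≤ θ k ω} ≤ δ := by
  have hd1 : (1 : ℝ) ≤ d := by exact_mod_cast hd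
  have hd0 : (0 : ℝ) < d := by linarith
  set r : ℝ := 1 - 1 / (d : ℝ) ^ 2 with hr
  have hd2 : (1 : ℝ) ≤ (d : ℝ) ^ 2 := one_le_pow₀ hd1
  have hr0 : 0 ≤ r := by
    rw [hr, sub_nonneg, div_le_one (by positivity)]; exact hd2
  have hr1 : r < 1 := by
    rw [hr]
    have : 0 < 1 / (d : ℝ) ^ 2 := by positivity
    linarith
  have hp : 0 < 1 - 1 / ((d : ℝ) + 1) := by
    rw [sub_pos, div_lt_one (by positivity)]; linarith
  -- Giving up the ratio `1 - 1/(d + 1)` leaves a surplus `r = 1 - 1/d²`. Markov bounds the `k`-th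
  -- failure by `(δ/d²) rᵏ`, and these sum exactly to `δ`.
  have hrr : 1 - 1 / (d : ℝ) = r * (1 - 1 / ((d : ℝ) + 1)) := by
    rw [hr]
    field_simp
    ring
  have hk : ∀ k, P {ω | d ^ 2 * C / δ * (1 - 1 / ((d : ℝ) + 1)) ^ k ≤ θ k ω} ≤
      ENNReal.ofReal (δ / d ^ 2 * r ^ k) := fun k => by
    rw [← ofReal_measureReal]
    refine ENNReal.ofReal_le_ofReal ?_
    have h1 := mul_meas_ge_le_integral_of_nonneg (.of_forall (hθ k)) (hi k)
      (d ^ 2 * C / δ * (1 - 1 / ((d : ℝ) + 1)) ^ k)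
    have h2 := h1.trans (h k)
    rw [hrr, mul_pow, ← le_div_iff₀' (by positivity)] at h2
    refine h2.trans (le_of_eq ?_)
    have := (pow_pos hp k).ne'
    field_simp
  have hs : Summable fun k => δ / (d : ℝ) ^ 2 * r ^ k :=
    (summable_geometric_of_lt_one hr0 hr1).mul_left _
  have hsum : ∑' k, δ / (d : ℝ) ^ 2 * r ^ k = δ := by
    rw [tsum_mul_left, tsum_geometric_of_lt_one hr0 hr1, hr]
    field_simp
    ring
  refine ENNReal.toReal_le_of_le_ofReal hδ.le ?_
  rw [Set.ofPred_exists]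
  calc _ ≤ ∑' k, P {ω | d ^ 2 * C / δ * (1 - 1 / ((d : ℝ) + 1)) ^ k ≤ θ k ω} :=
        measure_iUnion_le _
    _ ≤ ∑' k, ENNReal.ofReal (δ / d ^ 2 * r ^ k) := ENNReal.tsum_le_tsum hk
    _ = ENNReal.ofReal δ := by
        rw [← ENNReal.ofReal_tsum_of_nonneg (fun k => by positivity) hs, hsum]

/-- The rates of a random method, with high probability. -/
theorem random_hasRates (hd : 2 ≤ d) {f : (Fin d → ℝ) → ℝ} {M μ L η : ℝ}
    (hf : StronglyConvexSmooth μ L f) (hM : StronglySelfConcordant M f) (hη : 1 ≤ η)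
    {x₀ : Fin d → ℝ} {G₀ : Matrix (Fin d) (Fin d) ℝ} (hG₀ : LoewnerLE (hess f x₀) G₀)
    (hG₀η : LoewnerLE G₀ (η • hess f x₀)) {c β : ℝ} (hc : 4 ≤ c)
    (hlog : 4 * η * (c + 1) * (M * lam f x₀) ≤ Real.log 2)
    (hν : IsIsotropicDirection ν) (hw : IsIIDWithLaw P w ν)
    {x : Ω → ℕ → Fin d → ℝ} {G : Ω → ℕ → Matrix (Fin d) (Fin d) ℝ}
    (hrun : ∀ ω, IsUpdateRun f M (x ω) (G ω)) (hx0 : ∀ ω, x ω 0 = x₀) (hG0 : ∀ ω, G ω 0 = G₀)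
    {V W : Ω → ℕ → ℝ} {B : ℕ → Ω → Matrix (Fin d) (Fin d) ℝ}
    (mx : ∀ k, Measurable fun ω => x ω k)
    (mV : ∀ k, Measurable fun ω => V ω k) (mW : ∀ k, Measurable fun ω => W ω k)
    (mB : ∀ k i j, Measurable[past w k] fun ω => B k ω i j)
    (hp : ∀ ω, (∀ k, LoewnerLE (hess f (x ω k)) (G ω k)) →
      IsPotential f M (x ω) (G ω) c (V ω) (W ω))
    (hV0 : ∀ ω, V ω 0 ≤ c / 2 * (η - 1))
    (hB : ∀ ω, (∀ k, LoewnerLE (hess f (x ω k)) (G ω k)) → ∀ k, (B k ω).PosSemidef ∧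
      (B k ω).trace = W ω k + d * β ∧ V ω (k + 1) ≤
        W ω k + β - (w k ω ⬝ᵥ w k ω)⁻¹ * (w k ω ⬝ᵥ (B k ω *ᵥ w k ω)))
    {δ : ℝ} (hδ : 0 < δ) :
    1 - δ ≤ P.real {ω | HasRates f (x ω) (G ω) (d ^ 2 * (2 * (c * η)) / δ) (1 - 1 / (d + 1))} := by
  have ha : 0 ≤ M * lam f x₀ := mul_nonneg hM.constant_pos.le (lam_nonneg _ _)
  have hlog' := four_mul_log_le hη hc ha hlog
  have hc0 : 0 ≤ c := by linarith
  have hd0 : 0 < d := by omega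
  have hlin := fun ω => (hrun ω).linear_rate hf hM hη (by rw [hx0, hG0]; exact hG₀)
    (by rw [hx0, hG0]; exact hG₀η) (by rw [hx0]; exact hlog')
  have hG := fun ω k => (hlin ω k).1
  have hp := fun ω => hp ω (hG ω)
  have hB := fun ω => hB ω (hG ω)
  have hl : ∀ ω k, _ := fun ω k =>
    mul_lam_le_one hη hM (by rw [hx0]; exact hlog') (hlin ω k).2.2
  simp only [hx0] at hl
  have hθ := fun ω k => theta_nonneg hf hM (hp ω) hc0 (hG ω) k
  have hlam := fun ω k =>
    (hrun ω).lam_succ_le hf hM (hp ω) hc (hG ω) ((hl ω k).1.trans (hl ω k).2.1)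
  have ht : ∀ ω, V ω 0 + c * (M * lam f (x ω 0)) ≤ c * η / 2 := fun ω => by
    have := (hl ω 0).2.2
    rw [hx0]
    nlinarith [hV0 ω]
  have key := expected_contraction hd0 hν hw (V := fun k ω => V ω k) (W := fun k ω => W ω k)
    (l := fun k ω => M * lam f (x ω k)) hη ha hc0 mV mW
    (fun k => (measurable_lam f (mx k)).const_mul M) mB (fun k ω => (hθ ω k).1)
    (fun k ω => mul_nonneg hM.constant_pos.le (lam_nonneg _ _)) ht
    (fun k ω => corr_potential_le hf hM (hp ω) hc0 (hG ω) (hl ω k).1)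
    (fun k ω => by
      have h1 := mul_le_mul_of_nonneg_left (hlam ω k) hM.constant_pos.le
      have h2 := mul_le_mul_of_nonneg_right (hl ω k).1 (hθ ω k).2
      rw [theta] at h1 h2
      linarith)
    (fun k ω => (hB ω k).1) (fun k ω => (hB ω k).2.1) (fun k ω => (hB ω k).2.2)
  have hE0 : ∀ k, 0 ≤ ∫ ω, V ω k + c * (M * lam f (x ω k)) ∂P := fun k =>
    integral_nonneg fun ω => (hθ ω k).2
  have hE : ∀ k, ∫ ω, V ω k + c * (M * lam f (x ω k)) ∂P ≤
      2 * (c * η) * (1 - 1 / (d : ℝ)) ^ k :=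
    fun k => by
    have hρ := half_le_ratio hd
    have h1 := le_of_contraction hρ hc0 hη ha hlog hE0 (fun k => (key k).2) k
    have h2 : ∫ ω, V ω 0 + c * (M * lam f (x ω 0)) ∂P ≤ c * η / 2 := by
      refine (integral_mono (key 0).1 (integrable_const (c * η / 2)) ht).trans ?_
      simp
    have h3 : 0 ≤ (1 - 1 / (d : ℝ)) ^ k := pow_nonneg (by linarith) k
    have h4 := mul_le_mul_of_nonneg_left h2 (mul_nonneg two_pos.le h3)
    have h5 : 0 ≤ c * η * (1 - 1 / (d : ℝ)) ^ k := by positivity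
    linarith
  have hC : 0 < 2 * (c * η) := by positivity
  have htail := measure_geometric_tail_le hd0 (fun k ω => (hθ ω k).2) (fun k => (key k).1) hC hδ hE
  set bad := {ω | ∃ k, d ^ 2 * (2 * (c * η)) / δ * (1 - 1 / ((d : ℝ) + 1)) ^ k ≤
    theta f M (x ω) c (V ω) k}
  -- Only monotonicity and subadditivity are used, so the good event need not be shown measurable.
  have hcover : (Set.univ : Set Ω) ⊆
      {ω | HasRates f (x ω) (G ω) (d ^ 2 * (2 * (c * η)) / δ) (1 - 1 / (d + 1))} ∪ bad := by
    intro ω _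
    by_cases hω : ω ∈ bad
    · exact Or.inr hω
    · left
      have hω' : ∀ k, theta f M (x ω) c (V ω) k <
          d ^ 2 * (2 * (c * η)) / δ * (1 - 1 / ((d : ℝ) + 1)) ^ k := fun k => by
        by_contra h
        exact hω ⟨k, not_lt.1 h⟩
      have hr : (0 : ℝ) ≤ 1 - 1 / (d + 1) := by
        rw [sub_nonneg, div_le_one (by positivity)]
        linarith [show (0 : ℝ) ≤ d from Nat.cast_nonneg d]
      refine hasRates_of_theta_le (hG ω) (by positivity) hr (fun k => ?_) (fun k => (hω' k).le)
        (hlam ω)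
      have := mul_nonneg hc0 (mul_nonneg hM.constant_pos.le (lam_nonneg f (x ω k)))
      rw [theta]
      linarith [(hp ω).sigma_le k]
  have h1 := (measureReal_mono (μ := P) hcover).trans (measureReal_union_le _ _)
  rw [probReal_univ] at h1
  linarith

end Expectation

/-! ### The random BFGS and SR1 methods. -/

section RandomMethods

variable {d : ℕ} {Ω : Type*} [mΩ : MeasurableSpace Ω]

/-- The matrix that governs the decrease of `σ` in a BFGS step depends on the past only. -/
theorem entryMeasurable_scaled_bfgsRun (f : (Fin d → ℝ) → ℝ) (M : ℝ) (x₀ : Fin d → ℝ)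
    (G₀ K₀ : Matrix (Fin d) (Fin d) ℝ) {w : ℕ → Ω → Fin d → ℝ} (k : ℕ)
    (hw : ∀ j < k, Measurable (w j)) :
    EntryMeasurable fun ω =>
      (((bfgsRun f M x₀ G₀ K₀ (fun n => w n ω) k).corrK f M)⁻¹)ᵀ *
        (hess f (bfgsRun f M x₀ G₀ K₀ (fun n => w n ω) (k + 1)).x)⁻¹ *
        ((bfgsRun f M x₀ G₀ K₀ (fun n => w n ω) k).corrK f M)⁻¹ := by
  obtain ⟨hx, hG, hK⟩ := measurable_bfgsRun f M x₀ G₀ K₀ k hw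
  have hK' : EntryMeasurable fun ω =>
      (bfgsRun f M x₀ G₀ K₀ (fun n => w n ω) k).corrK f M :=
    .smul (measurable_corr f M hx hG).sqrt.inv hK
  exact (hK'.inv.transpose.mul
    (entryMeasurable_hess f (measurable_nextPoint f hx hG)).inv).mul hK'.inv

/-- The matrix that governs the decrease of the trace in an SR1 step depends on the past only. -/
theorem entryMeasurable_diff_sr1Run (f : (Fin d → ℝ) → ℝ) (M μ : ℝ) (x₀ : Fin d → ℝ)
    (G₀ : Matrix (Fin d) (Fin d) ℝ) {u : ℕ → Ω → Fin d → ℝ} (k : ℕ)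
    (hu : ∀ j < k, Measurable (u j)) :
    EntryMeasurable fun ω => μ⁻¹ • ((sr1Run f M x₀ G₀ (fun n => u n ω) k).corrG f M -
      hess f (sr1Run f M x₀ G₀ (fun n => u n ω) (k + 1)).x) := by
  obtain ⟨hx, hG⟩ := measurable_sr1Run f M x₀ G₀ k hu
  exact .smul measurable_const ((EntryMeasurable.smul (measurable_corr f M hx hG) hG).sub
    (entryMeasurable_hess f (measurable_nextPoint f hx hG)))

variable {f : (Fin d → ℝ) → ℝ} {M μ L η : ℝ} {x₀ : Fin d → ℝ}
  {G₀ K₀ : Matrix (Fin d) (Fin d) ℝ} {P : Measure Ω} [IsProbabilityMeasure P]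
  {ν : Measure (Fin d → ℝ)} {w : ℕ → Ω → Fin d → ℝ} {δ : ℝ}

theorem random_bfgs_hasRates (hd : 2 ≤ d) (hf : StronglyConvexSmooth μ L f)
    (hM : StronglySelfConcordant M f) (hη : 1 ≤ η) (hG₀ : LoewnerLE (hess f x₀) G₀)
    (hG₀η : LoewnerLE G₀ (η • hess f x₀))
    (hlog : M * lam f x₀ ≤ Real.log 2 / (4 * η * (2 * d + 1))) (hK₀ : K₀ᵀ * K₀ = G₀⁻¹)
    (hν : IsIsotropicDirection ν) (hw : IsIIDWithLaw P w ν) (hδ : 0 < δ) :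
    1 - δ ≤ P.real {ω | HasRates f
      (fun k => (bfgsRun f M x₀ G₀ K₀ (fun n => w n ω) k).x)
      (fun k => (bfgsRun f M x₀ G₀ K₀ (fun n => w n ω) k).G)
      (4 * d ^ 3 * η / δ) (1 - 1 / (d + 1))} := by
  have hm := fun k => measurable_bfgsRun f M x₀ G₀ K₀ (w := w) k fun j _ => hw.1 j
  have hrun := fun ω => isUpdateRun_bfgs (M := M) (x₀ := x₀) (G₀ := G₀) (K₀ := K₀) hf
    fun n => w n ω
  have key := random_hasRates hd hf hM hη hG₀ hG₀η (four_le_two_mul hd)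
    (mul_le_log_of_le_div hη (by positivity) hlog) hν hw hrun (fun _ => rfl) (fun _ => rfl)
    (β := 1) (fun k => (hm k).1)
    (fun k => measurable_sigma (entryMeasurable_hess f (hm k).1) (hm k).2.1)
    (fun k => measurable_sigma (entryMeasurable_hess f (hm (k + 1)).1)
      (.smul (measurable_corr f M (hm k).1 (hm k).2.1) (hm k).2.1))
    -- The lemma is instantiated with the σ-algebra of the first `k` directions: the matrix involves
    -- `x_{k+1}`, which is already determined by `x_k` and `G_k`.
    (fun k => @entryMeasurable_scaled_bfgsRun d Ω (past w k) f M x₀ G₀ K₀ w k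
      fun j hj => measurable_past w hj)
    (fun ω hG => isPotential_sigma hf hM (hrun ω).point hG)
    (fun ω => sigma_init_le (hf.posDef_hess x₀) hG₀ hG₀η)
    (fun ω hG k => by
      rw [mul_one]
      exact sigma_bfgsRun_succ_le hf hM hK₀ (fun k => (hG k).posDef (hf.posDef_hess _)) k) hδ
  rwa [show (d : ℝ) ^ 2 * (2 * (2 * d * η)) / δ = 4 * d ^ 3 * η / δ by ring] at key

theorem random_sr1_hasRates (hd : 2 ≤ d) (hf : StronglyConvexSmooth μ L f)
    (hM : StronglySelfConcordant M f) (hη : 1 ≤ η) (hG₀ : LoewnerLE (hess f x₀) G₀)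
    (hG₀η : LoewnerLE G₀ (η • hess f x₀))
    (hlog : M * lam f x₀ ≤ Real.log 2 / (4 * η * (2 * d * (L / μ) + 1)))
    (hν : IsSphericallySymmetric ν) (hw : IsIIDWithLaw P w ν) (hδ : 0 < δ) :
    1 - δ ≤ P.real {ω | HasRates f
      (fun k => (sr1Run f M x₀ G₀ (fun n => w n ω) k).x)
      (fun k => (sr1Run f M x₀ G₀ (fun n => w n ω) k).G)
      (4 * d ^ 3 * (L / μ) * η / δ) (1 - 1 / (d + 1))} := by
  have hm := fun k => measurable_sr1Run f M x₀ G₀ (u := w) k fun j _ => hw.1 j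
  have hrun := fun ω => isUpdateRun_sr1 (M := M) (x₀ := x₀) (G₀ := G₀) hf fun n => w n ω
  have hc := four_le_two_mul_mul hd hf
  have key := random_hasRates hd hf hM hη hG₀ hG₀η hc
    (mul_le_log_of_le_div hη (by linarith) hlog) (hν.isIsotropicDirection (by omega)) hw hrun
    (fun _ => rfl) (fun _ => rfl) (β := 0) (fun k => (hm k).1)
    (fun k => ((hm k).2.sub (entryMeasurable_hess f (hm k).1)).trace.div_const μ)
    (fun k => ((EntryMeasurable.smul (measurable_corr f M (hm k).1 (hm k).2) (hm k).2).sub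
      (entryMeasurable_hess f (hm (k + 1)).1)).trace.div_const μ)
    (fun k => @entryMeasurable_diff_sr1Run d Ω (past w k) f M μ x₀ G₀ w k
      fun j hj => measurable_past w hj)
    (fun ω hG => isPotential_trace hf hM (hrun ω).point hG)
    (fun ω => trace_init_le hf hη hG₀η)
    (fun ω hG k => by
      rw [mul_zero, add_zero]
      exact trace_sr1Run_succ_le hf hM hG k) hδ
  rwa [show (d : ℝ) ^ 2 * (2 * (2 * d * (L / μ) * η)) / δ = 4 * d ^ 3 * (L / μ) * η / δ by ring]
    at key

end RandomMethods

end QuasiNewton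

theorem mainTheorem5 {d : ℕ} (hd : 2 ≤ d) (f : (Fin d → ℝ) → ℝ) (M μ L η : ℝ)
    (hf : QuasiNewton.StronglyConvexSmooth μ L f)
    (hM : QuasiNewton.StronglySelfConcordant M f)
    (hη : 1 ≤ η) (x₀ : Fin d → ℝ) (G₀ : Matrix (Fin d) (Fin d) ℝ)
    (hG₀ : QuasiNewton.LoewnerLE (QuasiNewton.hess f x₀) G₀)
    (hG₀η : QuasiNewton.LoewnerLE G₀ (η • QuasiNewton.hess f x₀)) :
    -- BFGS
    (M * QuasiNewton.lam f x₀ ≤ Real.log 2 / (4 * η * (2 * d + 1)) →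
      ∀ K₀ : Matrix (Fin d) (Fin d) ℝ, K₀ᵀ * K₀ = G₀⁻¹ →
        -- greedy BFGS
        (∀ w : ℕ → Fin d → ℝ, QuasiNewton.IsGreedyBFGS f M x₀ G₀ K₀ w →
          QuasiNewton.HasRates f
            (fun k => (QuasiNewton.bfgsRun f M x₀ G₀ K₀ w k).x)
            (fun k => (QuasiNewton.bfgsRun f M x₀ G₀ K₀ w k).G)
            (2 * d * η) (1 - 1 / d)) ∧
        -- random BFGS
        (∀ (Ω : Type*) [MeasurableSpace Ω] (P : Measure Ω) [IsProbabilityMeasure P]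
          (ν : Measure (Fin d → ℝ)) (w : ℕ → Ω → Fin d → ℝ),
          QuasiNewton.IsIsotropicDirection ν → QuasiNewton.IsIIDWithLaw P w ν →
          ∀ δ : ℝ, 0 < δ → δ < 1 →
            1 - δ ≤ P.real {ω | QuasiNewton.HasRates f
              (fun k => (QuasiNewton.bfgsRun f M x₀ G₀ K₀ (fun n => w n ω) k).x)
              (fun k => (QuasiNewton.bfgsRun f M x₀ G₀ K₀ (fun n => w n ω) k).G)
              (4 * d ^ 3 * η / δ) (1 - 1 / (d + 1))})) ∧
    -- SR1
    (M * QuasiNewton.lam f x₀ ≤ Real.log 2 / (4 * η * (2 * d * (L / μ) + 1)) →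
        -- greedy SR1
        (∀ u : ℕ → Fin d → ℝ, QuasiNewton.IsGreedySR1 f M x₀ G₀ u →
          QuasiNewton.HasRates f
            (fun k => (QuasiNewton.sr1Run f M x₀ G₀ u k).x)
            (fun k => (QuasiNewton.sr1Run f M x₀ G₀ u k).G)
            (2 * d * (L / μ) * η) (1 - 1 / d)) ∧
        -- random SR1
        (∀ (Ω : Type*) [MeasurableSpace Ω] (P : Measure Ω) [IsProbabilityMeasure P]
          (ν : Measure (Fin d → ℝ)) (u : ℕ → Ω → Fin d → ℝ),
          QuasiNewton.IsSphericallySymmetric ν → QuasiNewton.IsIIDWithLaw P u ν →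
          ∀ δ : ℝ, 0 < δ → δ < 1 →
            1 - δ ≤ P.real {ω | QuasiNewton.HasRates f
              (fun k => (QuasiNewton.sr1Run f M x₀ G₀ (fun n => u n ω) k).x)
              (fun k => (QuasiNewton.sr1Run f M x₀ G₀ (fun n => u n ω) k).G)
              (4 * d ^ 3 * (L / μ) * η / δ) (1 - 1 / (d + 1))})) := by
  refine ⟨fun hlog K₀ hK₀ => ⟨fun w hw => ?_, ?_⟩, fun hlog => ⟨fun u hu => ?_, ?_⟩⟩
  · exact QuasiNewton.greedy_bfgs_hasRates hd hf hM hη hG₀ hG₀η hlog hK₀ hw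
  · intro Ω _ P _ ν w hν hw δ hδ _
    exact QuasiNewton.random_bfgs_hasRates hd hf hM hη hG₀ hG₀η hlog hK₀ hν hw hδ
  · exact QuasiNewton.greedy_sr1_hasRates hd hf hM hη hG₀ hG₀η hlog hu
  · intro Ω _ P _ ν u hν hu δ hδ _
    exact QuasiNewton.random_sr1_hasRates hd hf hM hη hG₀ hG₀η hlog hν hu hδ
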